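/- Let $d\in\mathbb N$, $1\le p\le\infty$ and let $0\ne g\in\mathcal S(\mathbb R^d)$. For a tempered distribution $u$ and $x\in\mathbb R^d$ put $T_xg(t)=g(t-x)$, and $$\|u\|_{W^{p,1}}=\Big(\int_{\mathbb R^d}\Big(\int_{\mathbb R^d}|\mathcal F(u\cdot T_xg)(w)|\,dw\Big)^{p}dx\Big)^{1/p}$$ (essential supremum in $x$ if $p=\infty$), where $\mathcal F h(w)=\int_{\mathbb R^d} h(t)e^{-2\pi i t\cdot w}\,dt$ is extended to tempered distributions. Let $W^{p,1}(\mathbb R^d)$ be the set of tempered distributions $u$ with $\|u\|_{W^{p,1}}<\infty$. Every element of $W^{p,1}(\mathbb R^d)$ is given by a bounded continuous function, so that the composition $T_F(f)=F\circ f$ is meaningful for $f\in W^{p,1}(\mathbb R^d)$. There is a constant $C>0$, depending only on $d$, $p$ and $g$, such that the following holds. Let $F:\mathbb C\to\mathbb C$ be real entire, i.e. $F(s+it)=\sum_{m,n=0}^\infty a_{mn}s^mt^n$ with complex coefficients $a_{mn}$ and absolute convergence for all $(s,t)\in\mathbb R^2$, and let $F(0)=0$. Then $T_F$ acts on $W^{p,1}(\mathbb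 R^d)$: for every $f\in W^{p,1}(\mathbb R^d)$ one has $F\circ f\in W^{p,1}(\mathbb R^d)$. Moreover $$\|T_F(f)\|_{W^{p,1}}\le C\sum_{m,n=0}^\infty|a_{mn}|\,\big(C\|f\|_{W^{p,1}}\big)^{m+n}<\infty ,$$ and, if the window $g$ is real-valued, then $$C\,\|T_F(f)\|_{W^{p,1}}\le\sum_{m,n=0}^\infty|a_{mn}|\,\big(C\|f\|_{W^{p,1}}\big)^{m+n},$$ that is, for the equivalent norm $\|\cdot\|'=C\|\cdot\|_{W^{p,1}}$ (the norm with window $Cg$) one has $\|T_F(f)\|'\le\sum_{m,n}|a_{mn}|\,(\|f\|')^{m+n}$. -/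

import Mathlib

open MeasureTheory SchwartzMap
open scoped ENNReal NNReal SchwartzMap

namespace WienerAmalgam

noncomputable section

/-- The Fourier character `t ↦ exp (-2 π i t · w)` on `ℝ^d`. -/
def fourierExp {d : ℕ} (w t : EuclideanSpace ℝ (Fin d)) : ℂ :=
  Complex.exp (-(2 * Real.pi * inner ℝ t w : ℝ) * Complex.I)

theorem hasTemperateGrowth_exp_mul_I :
    (fun s : ℝ => Complex.exp (-(s : ℂ) * Complex.I)).HasTemperateGrowth := by
  have hd : ∀ n : ℕ, iteratedDeriv n (fun s : ℝ => Complex.exp (-(s : ℂ) * Complex.I)) =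
      fun s : ℝ => (-Complex.I) ^ n * Complex.exp (-(s : ℂ) * Complex.I) := by
    intro n
    induction n with
    | zero => simp
    | succ n ih =>
      rw [iteratedDeriv_succ, ih]
      funext s
      have h1 : HasDerivAt (fun s : ℝ => -(s : ℂ) * Complex.I) (-1 * Complex.I) s :=
        ((Complex.ofRealCLM.hasDerivAt (x := s)).neg).mul_const Complex.I
      rw [(h1.cexp.const_mul ((-Complex.I) ^ n)).deriv]
      ring
  refine ⟨?_, fun n => ⟨0, 1, fun x => ?_⟩⟩
  · exact ((Complex.ofRealCLM.contDiff.neg).mul contDiff_const).cexp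
  · rw [norm_iteratedFDeriv_eq_norm_iteratedDeriv, hd]
    have : Complex.exp (-(x : ℂ) * Complex.I) = Complex.exp ((-x : ℝ) * Complex.I) := by simp
    simp only [norm_mul, norm_pow, this, Complex.norm_exp_ofReal_mul_I]
    simp

theorem hasTemperateGrowth_fourierExp {d : ℕ} (w : EuclideanSpace ℝ (Fin d)) :
    (fourierExp w).HasTemperateGrowth := by
  have h : (fun t : EuclideanSpace ℝ (Fin d) => 2 * Real.pi * inner ℝ t w).HasTemperateGrowth :=
    (Function.HasTemperateGrowth.const (2 * Real.pi)).mul (Function.hasTemperateGrowth_inner_left w)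
  exact hasTemperateGrowth_exp_mul_I.comp h

/-- The Schwartz function `t ↦ exp (-2 π i t · w) g (t - x)`. -/
def timeFreqShift {d : ℕ} (g : 𝓢(EuclideanSpace ℝ (Fin d), ℂ))
    (x w : EuclideanSpace ℝ (Fin d)) : 𝓢(EuclideanSpace ℝ (Fin d), ℂ) :=
  SchwartzMap.smulLeftCLM ℂ (fourierExp w) (SchwartzMap.compSubConstCLM ℂ x g)

theorem timeFreqShift_apply {d : ℕ} (g : 𝓢(EuclideanSpace ℝ (Fin d), ℂ))
    (x w t : EuclideanSpace ℝ (Fin d)) :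
    timeFreqShift g x w t = fourierExp w t * g (t - x) := by
  simp [timeFreqShift, SchwartzMap.smulLeftCLM_apply_apply (hasTemperateGrowth_fourierExp w)]

/-- `𝓕 (u · T_x g) (w)` for a tempered distribution `u`. The Fourier transform of the distribution
`u · T_x g` is the smooth function `w ↦ ⟨u, e^{-2 π i w ·} T_x g⟩`. -/
def localFourier {d : ℕ} (g : 𝓢(EuclideanSpace ℝ (Fin d), ℂ))
    (u : 𝓢'(EuclideanSpace ℝ (Fin d), ℂ)) (x w : EuclideanSpace ℝ (Fin d)) : ℂ :=
  u (timeFreqShift g x w)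

/-- The norm of `W^{p,q}(ℝ^d)` with window `g`: the `L^p` norm in `x` of the `L^q` norm in `w` of
`𝓕 (u · T_x g) (w)`. It takes values in `[0, ∞]`. -/
def amalgamNorm {d : ℕ} (g : 𝓢(EuclideanSpace ℝ (Fin d), ℂ)) (p q : ℝ≥0∞)
    (u : 𝓢'(EuclideanSpace ℝ (Fin d), ℂ)) : ℝ≥0∞ :=
  eLpNorm (fun x => eLpNorm (fun w => localFourier g u x w) q volume) p volume

/-- The Wiener amalgam space `W^{p,q}(ℝ^d)`, defined through the window `g`. -/
def amalgamSpace {d : ℕ} (g : 𝓢(EuclideanSpace ℝ (Fin d), ℂ)) (p q : ℝ≥0∞) :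
    Set 𝓢'(EuclideanSpace ℝ (Fin d), ℂ) :=
  {u | amalgamNorm g p q u < ∞}

/-- The tempered distribution `u` is (given by integration against) the function `f`. -/
def IsGivenBy {d : ℕ} (u : 𝓢'(EuclideanSpace ℝ (Fin d), ℂ))
    (f : EuclideanSpace ℝ (Fin d) → ℂ) : Prop :=
  ∀ φ : 𝓢(EuclideanSpace ℝ (Fin d), ℂ),
    Integrable (fun x => φ x * f x) volume ∧ u φ = ∫ x, φ x * f x

/-- `F (s + i t) = ∑ a_{mn} s^m t^n`, with absolute convergence for all real `s`, `t`. -/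
def IsRealEntireWith (F : ℂ → ℂ) (a : ℕ → ℕ → ℂ) : Prop :=
  ∀ s t : ℝ,
    Summable (fun k : ℕ × ℕ => ‖a k.1 k.2 * (s : ℂ) ^ k.1 * (t : ℂ) ^ k.2‖) ∧
    HasSum (fun k : ℕ × ℕ => a k.1 k.2 * (s : ℂ) ^ k.1 * (t : ℂ) ^ k.2) (F (s + t * Complex.I))

/-- `∑ |a_{mn}| r^{m+n}` in `[0, ∞]`. -/
def majorant (a : ℕ → ℕ → ℂ) (r : ℝ≥0∞) : ℝ≥0∞ :=
  ∑' k : ℕ × ℕ, ‖a k.1 k.2‖ₑ * r ^ (k.1 + k.2)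

end

end WienerAmalgam

/-! The space $W^{p,1}$ is, up to a constant, a Banach-type algebra under multiplication and
conjugation, and a real entire $F$ is a power series in $\mathrm{Re} f$ and $\mathrm{Im} f$; the
series is then bounded term by term.

Elements are functions. If $\mathcal F(u\cdot T_xg)$ is integrable, Fourier inversion shows that
$u\cdot T_xg$ is a continuous function $f_x$. Since $f_x\,T_yg=f_y\,T_xg$, the quotients $f_x/T_xg$
glue to one continuous $f$. Averaging the norm over a ball of positions $x$ bounds $f$, and a dual
window $\gamma$ with $\int g\gamma=1$ gives back $u=f$ (`exists_isGivenBy`). This needs $u$ to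
commute with integrals of Schwartz functions, which holds because $u$ factors through a Banach space
(`integral_apply_slice`).

Algebra. With window $g^2$, $\mathcal F(fh\,T_x(g^2))$ is the convolution of $\mathcal F(f\,T_xg)$
and $\mathcal F(h\,T_xg)$, so the local $L^1$ norms multiply (`stftNorm_mul_le`). A change of window
costs convolution in $x$ with a bounded integrable kernel (`exists_window_kernel`). This convolution
maps $L^p$ to itself and to $L^\infty$, so $g^2$ can be replaced by $g$ and one factor can be
measured in $L^\infty$; hence $\|fh\|\le A\|f\|\|h\|$ (`exists_functionNorm_mul_le`). Conjugating
$f$ amounts to conjugating the window, so $\mathrm{Re} f$ and $\mathrm{Im} f$ have norm at most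
$K\|f\|$, with $K=1$ for real $g$.

Then $A\|(\mathrm{Re} f)^m(\mathrm{Im} f)^n\|\le(AK\|f\|)^{m+n}$ for $m+n\ge1$; the constant term is
absent because $F(0)=0$. Summation gives the theorem with $C=AK$. -/

namespace WienerAmalgam

open Filter Topology LineDeriv FourierTransform

/-! ### Slices of Schwartz functions on a product. -/

section Slices

variable {X Y : Type*} [NormedAddCommGroup X] [NormedSpace ℝ X] [NormedAddCommGroup Y]
  [NormedSpace ℝ Y]

theorem norm_iteratedFDeriv_comp_clm_le {Z : Type*} [NormedAddCommGroup Z] [NormedSpace ℝ Z]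
    (L : Z →L[ℝ] X) (hL : ‖L‖ ≤ 1) (φ : 𝓢(X, ℂ)) (n : ℕ) (z : Z) :
    ‖iteratedFDeriv ℝ n (fun z => φ (L z)) z‖ ≤ ‖iteratedFDeriv ℝ n φ (L z)‖ := by
  have h := L.iteratedFDeriv_comp_right (φ.smooth n) z (i := n) le_rfl
  have h' : (fun z => φ (L z)) = φ ∘ L := rfl
  rw [h', h]
  refine (ContinuousMultilinearMap.norm_compContinuousLinearMap_le _ _).trans ?_
  refine mul_le_of_le_one_right (norm_nonneg _) ?_
  exact Finset.prod_le_one (fun _ _ => norm_nonneg _) fun _ _ => hL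

/-- The tensor product `(x, y) ↦ φ x * ψ y` of two Schwartz functions. -/
noncomputable def tensor (φ : 𝓢(X, ℂ)) (ψ : 𝓢(Y, ℂ)) : 𝓢(X × Y, ℂ) where
  toFun z := φ z.1 * ψ z.2
  smooth' := ((φ.smooth _).comp contDiff_fst).mul ((ψ.smooth _).comp contDiff_snd)
  decay' := by
    intro k n
    refine ⟨∑ i ∈ Finset.range (n + 1), (n.choose i : ℝ) *
      (SchwartzMap.seminorm ℝ k i φ * SchwartzMap.seminorm ℝ 0 (n - i) ψ +
        SchwartzMap.seminorm ℝ 0 i φ * SchwartzMap.seminorm ℝ k (n - i) ψ), fun z => ?_⟩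
    have h := norm_iteratedFDeriv_mul_le (𝕜 := ℝ) (N := n) (n := n)
      (f := fun z : X × Y => φ z.1) (g := fun z : X × Y => ψ z.2)
      ((φ.smooth _).comp contDiff_fst) ((ψ.smooth _).comp contDiff_snd) z le_rfl
    refine (mul_le_mul_of_nonneg_left h (by positivity)).trans ?_
    rw [Finset.mul_sum]
    refine Finset.sum_le_sum fun i _ => ?_
    have h1 := norm_iteratedFDeriv_comp_clm_le (ContinuousLinearMap.fst ℝ X Y)
      (ContinuousLinearMap.norm_fst_le _ _ _) φ i z
    have h2 := norm_iteratedFDeriv_comp_clm_le (ContinuousLinearMap.snd ℝ X Y)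
      (ContinuousLinearMap.norm_snd_le _ _ _) ψ (n - i) z
    simp only [ContinuousLinearMap.coe_fst', ContinuousLinearMap.coe_snd'] at h1 h2
    have hz : ‖z‖ ^ k ≤ ‖z.1‖ ^ k + ‖z.2‖ ^ k := by
      rcases max_choice ‖z.1‖ ‖z.2‖ with h | h <;> rw [Prod.norm_def, h]
      · exact le_add_of_nonneg_right (by positivity)
      · exact le_add_of_nonneg_left (by positivity)
    have a1 := le_seminorm ℝ k i φ z.1
    have a2 := norm_iteratedFDeriv_le_seminorm ℝ ψ (n - i) z.2
    have a3 := norm_iteratedFDeriv_le_seminorm ℝ φ i z.1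
    have a4 := le_seminorm ℝ k (n - i) ψ z.2
    calc ‖z‖ ^ k * (n.choose i * ‖iteratedFDeriv ℝ i (fun z : X × Y => φ z.1) z‖ *
          ‖iteratedFDeriv ℝ (n - i) (fun z : X × Y => ψ z.2) z‖)
        ≤ (‖z.1‖ ^ k + ‖z.2‖ ^ k) * (n.choose i * ‖iteratedFDeriv ℝ i φ z.1‖ *
          ‖iteratedFDeriv ℝ (n - i) ψ z.2‖) := by gcongr
      _ = n.choose i * ((‖z.1‖ ^ k * ‖iteratedFDeriv ℝ i φ z.1‖) *
            ‖iteratedFDeriv ℝ (n - i) ψ z.2‖ + ‖iteratedFDeriv ℝ i φ z.1‖ *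
            (‖z.2‖ ^ k * ‖iteratedFDeriv ℝ (n - i) ψ z.2‖)) := by ring
      _ ≤ _ := by gcongr

theorem tensor_apply (φ : 𝓢(X, ℂ)) (ψ : 𝓢(Y, ℂ)) (z : X × Y) :
    tensor φ ψ z = φ z.1 * ψ z.2 := rfl

theorem iteratedFDeriv_slice (H : 𝓢(X × Y, ℂ)) (y : Y) (n : ℕ) (x : X) :
    iteratedFDeriv ℝ n (fun x => H (x, y)) x =
      (iteratedFDeriv ℝ n H (x, y)).compContinuousLinearMap
        fun _ => ContinuousLinearMap.inl ℝ X Y := by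
  have h := (ContinuousLinearMap.inl ℝ X Y).iteratedFDeriv_comp_right (n := n) (i := n)
    (f := fun z => H (z + (0, y)))
    ((H.smooth n).comp (contDiff_id.add contDiff_const)) x le_rfl
  have e : (fun x => H (x, y)) = (fun z => H (z + (0, y))) ∘ ContinuousLinearMap.inl ℝ X Y := by
    funext x; simp
  rw [e, h, iteratedFDeriv_comp_add_right]
  simp

theorem norm_compContinuousLinearMap_inl_le {n : ℕ} (M : (X × Y) [×n]→L[ℝ] ℂ) :
    ‖M.compContinuousLinearMap fun _ => ContinuousLinearMap.inl ℝ X Y‖ ≤ ‖M‖ := by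
  refine (ContinuousMultilinearMap.norm_compContinuousLinearMap_le _ _).trans ?_
  refine mul_le_of_le_one_right (norm_nonneg _) ?_
  exact Finset.prod_le_one (fun _ _ => norm_nonneg _)
    fun _ _ => ContinuousLinearMap.norm_inl_le_one ℝ X Y

/-- The weight $(1+\|(x,y)\|)^{k+N}$ dominates both $\|x\|^k$ and $(1+\|y\|)^N$. The arbitrary decay
in $y$ makes every later integral over slices converge. -/
theorem slice_bound (H : 𝓢(X × Y, ℂ)) (k n N : ℕ) :
    ∃ C : ℝ, 0 ≤ C ∧ ∀ (y : Y) (x : X),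
      ‖x‖ ^ k * ‖iteratedFDeriv ℝ n (fun x => H (x, y)) x‖ ≤ C * (1 + ‖y‖) ^ (-(N : ℝ)) := by
  refine ⟨2 ^ (k + N) * ((Finset.Iic (k + N, n)).sup fun m => SchwartzMap.seminorm ℝ m.1 m.2) H,
    by positivity, fun y x => ?_⟩
  have h := one_add_le_sup_seminorm_apply (𝕜 := ℝ) (m := (k + N, n)) le_rfl le_rfl H (x, y)
  have hy : 0 < 1 + ‖y‖ := by positivity
  rw [Real.rpow_neg hy.le, Real.rpow_natCast, ← div_eq_mul_inv, le_div_iff₀ (by positivity)]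
  refine le_trans ?_ h
  rw [iteratedFDeriv_slice, pow_add]
  have h1 : ‖x‖ ≤ 1 + ‖(x, y)‖ := by
    have : ‖x‖ ≤ ‖(x, y)‖ := norm_fst_le (x, y)
    linarith
  have h2 : 1 + ‖y‖ ≤ 1 + ‖(x, y)‖ := by
    have : ‖y‖ ≤ ‖(x, y)‖ := norm_snd_le (x, y)
    linarith
  have h3 := norm_compContinuousLinearMap_inl_le (iteratedFDeriv ℝ n H (x, y))
  rw [mul_right_comm]
  gcongr

/-- The Schwartz function `x ↦ H (x, y)`. -/
noncomputable def slice (H : 𝓢(X × Y, ℂ)) (y : Y) : 𝓢(X, ℂ) where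
  toFun x := H (x, y)
  smooth' := (H.smooth _).comp (contDiff_id.prodMk contDiff_const)
  decay' := fun k n => by
    obtain ⟨C, -, hC⟩ := slice_bound H k n 0
    exact ⟨C, fun x => by simpa using hC y x⟩

@[simp]
theorem slice_apply (H : 𝓢(X × Y, ℂ)) (y : Y) (x : X) : slice H y x = H (x, y) := rfl

theorem coe_slice (H : 𝓢(X × Y, ℂ)) (y : Y) : ⇑(slice H y) = fun x => H (x, y) := rfl

theorem seminorm_slice_le (H : 𝓢(X × Y, ℂ)) (k n N : ℕ) :
    ∃ C : ℝ, 0 ≤ C ∧ ∀ y : Y,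
      SchwartzMap.seminorm ℂ k n (slice H y) ≤ C * (1 + ‖y‖) ^ (-(N : ℝ)) := by
  obtain ⟨C, hC0, hC⟩ := slice_bound H k n N
  exact ⟨C, hC0, fun y => seminorm_le_bound ℂ k n _ (by positivity) fun x => hC y x⟩

/-- Mean value inequality in $y$, at the price of one more derivative of $H$. -/
theorem seminorm_slice_sub_le (H : 𝓢(X × Y, ℂ)) (k n : ℕ) (y y' : Y) :
    SchwartzMap.seminorm ℂ k n (slice H y - slice H y') ≤
      SchwartzMap.seminorm ℝ k (n + 1) H * ‖y - y'‖ := by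
  refine seminorm_le_bound ℂ k n _ (by positivity) fun x => ?_
  have hs : ⇑(slice H y - slice H y') = ⇑(slice H y) - ⇑(slice H y') := by ext; simp
  rw [hs, iteratedFDeriv_sub_apply ((slice H y).smooth _).contDiffAt
    ((slice H y').smooth _).contDiffAt, coe_slice, coe_slice, iteratedFDeriv_slice,
    iteratedFDeriv_slice]
  have e : (iteratedFDeriv ℝ n H (x, y)).compContinuousLinearMap
        (fun _ => ContinuousLinearMap.inl ℝ X Y) -
      (iteratedFDeriv ℝ n H (x, y')).compContinuousLinearMap
        (fun _ => ContinuousLinearMap.inl ℝ X Y) =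
      (iteratedFDeriv ℝ n H (x, y) - iteratedFDeriv ℝ n H (x, y')).compContinuousLinearMap
        (fun _ => ContinuousLinearMap.inl ℝ X Y) := by
    ext; simp
  rw [e]
  -- If the weight vanishes there is nothing to prove; otherwise dividing by it bounds the
  -- $y$-derivative uniformly in $z$.
  rcases (pow_nonneg (norm_nonneg x) k).eq_or_lt with hx | hx
  · rw [← hx, zero_mul]
    positivity
  have hd : ∀ z : Y, HasFDerivAt (fun z => iteratedFDeriv ℝ n H (x, z))
      ((fderiv ℝ (iteratedFDeriv ℝ n H) (x, z)).comp (ContinuousLinearMap.inr ℝ X Y)) z :=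
    fun z => by
      have h1 : HasFDerivAt (iteratedFDeriv ℝ n H) (fderiv ℝ (iteratedFDeriv ℝ n H) (x, z))
          (x, z) :=
        (((H.smooth ⊤).differentiable_iteratedFDeriv
          (mod_cast ENat.natCast_lt_top n)) (x, z)).hasFDerivAt
      exact h1.comp z (hasFDerivAt_prodMk_right x z)
  have hb : ∀ z : Y, ‖(fderiv ℝ (iteratedFDeriv ℝ n H) (x, z)).comp
      (ContinuousLinearMap.inr ℝ X Y)‖ ≤ SchwartzMap.seminorm ℝ k (n + 1) H / ‖x‖ ^ k :=
    fun z => by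
      rw [le_div_iff₀ hx, mul_comm]
      have h1 : ‖(fderiv ℝ (iteratedFDeriv ℝ n H) (x, z)).comp
          (ContinuousLinearMap.inr ℝ X Y)‖ ≤ ‖iteratedFDeriv ℝ (n + 1) H (x, z)‖ := by
        refine (ContinuousLinearMap.opNorm_comp_le _ _).trans ?_
        rw [norm_fderiv_iteratedFDeriv]
        exact mul_le_of_le_one_right (norm_nonneg _) (ContinuousLinearMap.norm_inr_le_one ℝ X Y)
      have h2 : ‖x‖ ≤ ‖(x, z)‖ := norm_fst_le (x, z)
      refine le_trans ?_ (le_seminorm ℝ k (n + 1) H (x, z))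
      gcongr
  have hm := Convex.norm_image_sub_le_of_norm_hasFDerivWithin_le
    (fun z (_ : z ∈ Set.univ) => (hd z).hasFDerivWithinAt) (fun z _ => hb z) convex_univ
    (Set.mem_univ y') (Set.mem_univ y)
  rw [div_mul_eq_mul_div, le_div_iff₀ hx, mul_comm] at hm
  refine le_trans ?_ hm
  gcongr
  exact norm_compContinuousLinearMap_inl_le _

theorem continuous_slice (H : 𝓢(X × Y, ℂ)) : Continuous (slice H) := by
  rw [continuous_iff_continuousAt]
  intro y'
  refine ((schwartz_withSeminorms ℂ X ℂ).tendsto_nhds _ _).2 fun i ε hε => ?_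
  have h1 : Tendsto (fun y => SchwartzMap.seminorm ℝ i.1 (i.2 + 1) H * ‖y - y'‖) (𝓝 y') (𝓝 0) := by
    have : Continuous fun y => SchwartzMap.seminorm ℝ i.1 (i.2 + 1) H * ‖y - y'‖ := by fun_prop
    simpa using this.tendsto y'
  filter_upwards [h1.eventually (gt_mem_nhds hε)] with y hy
  exact (seminorm_slice_sub_le H i.1 i.2 y y').trans_lt hy

end Slices

/-! ### Tempered distributions commute with integrals of slices. -/

section Exchange

variable {X Y : Type*} [NormedAddCommGroup X] [NormedSpace ℝ X] [NormedAddCommGroup Y]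
  [NormedSpace ℝ Y]

/-- Bounded continuous functions, with the metric of the target coming from its norm. -/
abbrev BoundedFunctions (X V : Type*) [TopologicalSpace X] [NormedAddCommGroup V] :=
  BoundedContinuousFunction X V

/-- The bounded continuous function `x ↦ ‖x‖ ^ k • D ^ n φ x`. -/
noncomputable def weightedDeriv (k n : ℕ) :
    𝓢(X, ℂ) →ₗ[ℂ] BoundedFunctions X (X [×n]→L[ℝ] ℂ) where
  toFun φ := BoundedContinuousFunction.ofNormedAddCommGroup
    (fun x => ‖x‖ ^ k • iteratedFDeriv ℝ n φ x)
    ((continuous_norm.pow k).smul ((φ.smooth n).continuous_iteratedFDeriv le_rfl))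
    (SchwartzMap.seminorm ℝ k n φ) fun x => by
      rw [norm_smul, norm_pow, norm_norm]
      exact le_seminorm ℝ k n φ x
  map_add' φ ψ := by
    ext1 x
    have hs : ⇑(φ + ψ) = ⇑φ + ⇑ψ := by ext; simp
    simp [hs, iteratedFDeriv_add_apply (φ.smooth n).contDiffAt (ψ.smooth n).contDiffAt]
  map_smul' c φ := by
    ext1 x
    have hs : ⇑(c • φ) = c • ⇑φ := by ext; simp
    simp only [hs, RingHom.id_apply, BoundedContinuousFunction.coe_smul,
      BoundedContinuousFunction.coe_ofNormedAddCommGroup,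
      iteratedFDeriv_const_smul_apply (φ.smooth n).contDiffAt]
    rw [smul_comm]

theorem weightedDeriv_apply (k n : ℕ) (φ : 𝓢(X, ℂ)) (x : X) :
    weightedDeriv k n φ x = ‖x‖ ^ k • iteratedFDeriv ℝ n φ x := rfl

theorem norm_weightedDeriv_le (k n : ℕ) (φ : 𝓢(X, ℂ)) :
    ‖weightedDeriv k n φ‖ ≤ SchwartzMap.seminorm ℂ k n φ :=
  (BoundedContinuousFunction.norm_le (by positivity)).2 fun x => by
    rw [weightedDeriv_apply, norm_smul, norm_pow, norm_norm]
    exact le_seminorm ℂ k n φ x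

theorem seminorm_le_norm_weightedDeriv (k n : ℕ) (φ : 𝓢(X, ℂ)) :
    SchwartzMap.seminorm ℂ k n φ ≤ ‖weightedDeriv k n φ‖ :=
  seminorm_le_bound ℂ k n φ (norm_nonneg _) fun x => by
    refine le_trans (le_of_eq ?_) ((weightedDeriv k n φ).norm_coe_le_norm x)
    rw [weightedDeriv_apply, norm_smul, norm_pow, norm_norm]

theorem continuous_weightedDeriv (k n : ℕ) : Continuous (weightedDeriv (X := X) k n) := by
  refine WithSeminorms.continuous_of_isBounded (schwartz_withSeminorms ℂ X ℂ)
    (norm_withSeminorms ℂ (BoundedFunctions X (X [×n]→L[ℝ] ℂ))) _ fun i => ?_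
  refine ⟨{(k, n)}, 1, fun φ => ?_⟩
  simpa using norm_weightedDeriv_le k n φ

theorem exists_bound_seminorm (u : 𝓢'(X, ℂ)) : ∃ (s : Finset (ℕ × ℕ)) (C : ℝ), 0 ≤ C ∧
    ∀ φ, ‖u φ‖ ≤ C * (s.sup (schwartzSeminormFamily ℂ X ℂ)) φ := by
  have hc : Continuous ((normSeminorm ℂ ℂ).comp (u : 𝓢(X, ℂ) →ₗ[ℂ] ℂ)) :=
    continuous_norm.comp u.continuous
  obtain ⟨s, C, -, h⟩ := Seminorm.bound_of_continuous (schwartz_withSeminorms ℂ X ℂ) _ hc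
  exact ⟨s, C, C.2, fun φ => h φ⟩

/-- A tempered distribution factors through a continuous linear form on a Banach space of
weighted derivatives. -/
theorem exists_extension (u : 𝓢'(X, ℂ)) : ∃ (s : Finset (ℕ × ℕ))
    (L : (∀ i : s, BoundedFunctions X (X [×i.1.2]→L[ℝ] ℂ)) →L[ℂ] ℂ),
    ∀ φ : 𝓢(X, ℂ), u φ = L fun i : s => weightedDeriv i.1.1 i.1.2 φ := by
  obtain ⟨s, C, hC, hu⟩ := exists_bound_seminorm u
  let B := ∀ i : s, BoundedFunctions X (X [×i.1.2]→L[ℝ] ℂ)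
  let ι : 𝓢(X, ℂ) →ₗ[ℂ] B := LinearMap.pi fun i : s => weightedDeriv i.1.1 i.1.2
  have hι : ∀ φ, ‖u φ‖ ≤ C * ‖ι φ‖ := fun φ => by
    refine (hu φ).trans (mul_le_mul_of_nonneg_left ?_ hC)
    refine Seminorm.finset_sup_apply_le (norm_nonneg _) fun i hi => ?_
    exact (seminorm_le_norm_weightedDeriv i.1 i.2 φ).trans (norm_le_pi_norm (ι φ) ⟨i, hi⟩)
  -- The bound `hι` makes $u$ vanish on the kernel of `ι`, so it descends to a bounded form on the
  -- range, which Hahn–Banach extends.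
  have hker : LinearMap.ker ι ≤ LinearMap.ker (u : 𝓢(X, ℂ) →ₗ[ℂ] ℂ) := fun φ hφ => by
    rw [LinearMap.mem_ker] at hφ ⊢
    have : ‖u φ‖ ≤ 0 := by simpa only [hφ, norm_zero, mul_zero] using hι φ
    exact norm_le_zero_iff.1 this
  let l : LinearMap.range ι →ₗ[ℂ] ℂ :=
    ((LinearMap.ker ι).liftQ _ hker) ∘ₗ (LinearMap.quotKerEquivRange ι).symm.toLinearMap
  have hl : ∀ φ, l ⟨ι φ, φ, rfl⟩ = u φ := fun φ => by
    have : ι.quotKerEquivRange.symm ⟨ι φ, φ, rfl⟩ = Submodule.Quotient.mk φ := by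
      rw [LinearEquiv.symm_apply_eq]; rfl
    simp only [l, LinearMap.comp_apply, LinearEquiv.coe_coe, this]
    rfl
  obtain ⟨L, hL, -⟩ := exists_extension_norm_eq _ (l.mkContinuous C (by
    rintro ⟨_, φ, rfl⟩
    rw [hl]
    exact hι φ))
  refine ⟨s, L, fun φ => ?_⟩
  have := hL ⟨ι φ, φ, rfl⟩
  rw [LinearMap.mkContinuous_apply, hl] at this
  exact this.symm

theorem lineDerivOp_slice (H : 𝓢(X × Y, ℂ)) (m x : X) (y : Y) :
    ∂_{m} (slice H y) x = (∂_{((m, 0) : X × Y)} H) (x, y) := by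
  rw [lineDerivOp_apply_eq_fderiv, lineDerivOp_apply_eq_fderiv]
  have h1 : HasFDerivAt (fun x => H (x, y)) ((fderiv ℝ H (x, y)).comp
      (ContinuousLinearMap.inl ℝ X Y)) x :=
    (H.hasFDerivAt (x, y)).comp x (hasFDerivAt_prodMk_left x y)
  rw [coe_slice, h1.fderiv]
  simp

theorem iteratedLineDerivOp_slice {n : ℕ} (H : 𝓢(X × Y, ℂ)) (m : Fin n → X) (x : X) (y : Y) :
    ∂^{m} (slice H y) x = (∂^{fun i => ((m i, 0) : X × Y)} H) (x, y) := by
  induction n generalizing x with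
  | zero => simp
  | succ n ih =>
    rw [iteratedLineDerivOp_succ_left, iteratedLineDerivOp_succ_left]
    have : ∂^{Fin.tail m} (slice H y) = slice (∂^{fun i => ((Fin.tail m i, 0) : X × Y)} H) y := by
      ext x; exact ih _ x
    rw [this]
    exact lineDerivOp_slice _ _ _ _

variable [MeasurableSpace Y] [BorelSpace Y] (μ : Measure Y) [μ.HasTemperateGrowth]

theorem integrable_slice (H : 𝓢(X × Y, ℂ)) (x : X) : Integrable (fun y => H (x, y)) μ := by
  obtain ⟨C, hC0, hC⟩ := slice_bound H 0 0 μ.integrablePower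
  refine ((μ.integrable_pow_neg_integrablePower).const_mul C).mono'
    (H.continuous.comp (by fun_prop)).aestronglyMeasurable (ae_of_all _ fun y => ?_)
  simpa using hC y x

/-- Differentiation under the integral along the line $x+sm$; the slice bound of the derivative is
an integrable majorant independent of $s$. -/
theorem lineDerivOp_integral (H : 𝓢(X × Y, ℂ)) (φ : 𝓢(X, ℂ))
    (h : ∀ x, φ x = ∫ y, H (x, y) ∂μ) (m x : X) :
    ∂_{m} φ x = ∫ y, (∂_{((m, 0) : X × Y)} H) (x, y) ∂μ := by
  obtain ⟨C, hC0, hC⟩ := slice_bound (∂_{((m, 0) : X × Y)} H) 0 0 μ.integrablePower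
  have hline : ∀ s : ℝ, HasDerivAt (fun s : ℝ => x + s • m) m s := fun s => by
    simpa using ((hasDerivAt_id s).smul_const m).const_add x
  have hF := (hasDerivAt_integral_of_dominated_loc_of_deriv_le (𝕜 := ℝ) (μ := μ) (s := Set.univ)
    (F := fun s y => H (x + s • m, y)) (x₀ := 0)
    (F' := fun s y => (∂_{((m, 0) : X × Y)} H) (x + s • m, y))
    (bound := fun y => C * (1 + ‖y‖) ^ (-(μ.integrablePower : ℝ))) Filter.univ_mem
    (Eventually.of_forall fun s => (integrable_slice μ H _).aestronglyMeasurable)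
    (integrable_slice μ H _) (integrable_slice μ (∂_{((m, 0) : X × Y)} H) _).aestronglyMeasurable
    (ae_of_all _ fun y s _ => by simpa using hC y (x + s • m))
    ((μ.integrable_pow_neg_integrablePower).const_mul C)
    (ae_of_all _ fun y s _ => by
      rw [← lineDerivOp_slice, lineDerivOp_apply_eq_fderiv]
      exact ((slice H y).hasFDerivAt (x + s • m)).comp_hasDerivAt s (hline s))).2
  have hφ : HasDerivAt (fun s : ℝ => φ (x + s • m)) (fderiv ℝ φ (x + (0 : ℝ) • m) m) 0 :=
    (φ.hasFDerivAt (x + (0 : ℝ) • m)).comp_hasDerivAt (0 : ℝ) (hline 0)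
  have := hφ.unique (by simpa only [h] using hF)
  simpa [lineDerivOp_apply_eq_fderiv] using this

theorem iteratedLineDerivOp_integral {n : ℕ} (H : 𝓢(X × Y, ℂ)) (φ : 𝓢(X, ℂ))
    (h : ∀ x, φ x = ∫ y, H (x, y) ∂μ) (m : Fin n → X) (x : X) :
    ∂^{m} φ x = ∫ y, (∂^{fun i => ((m i, 0) : X × Y)} H) (x, y) ∂μ := by
  induction n generalizing x with
  | zero => simpa using h x
  | succ n ih =>
    rw [iteratedLineDerivOp_succ_left, iteratedLineDerivOp_succ_left]
    exact lineDerivOp_integral μ _ _ (fun x => ih (Fin.tail m) x) _ _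

theorem iteratedFDeriv_integral_slice {n : ℕ} (H : 𝓢(X × Y, ℂ)) (φ : 𝓢(X, ℂ))
    (h : ∀ x, φ x = ∫ y, H (x, y) ∂μ) (m : Fin n → X) (x : X) :
    iteratedFDeriv ℝ n φ x m = ∫ y, iteratedFDeriv ℝ n (slice H y) x m ∂μ := by
  simp_rw [← iteratedLineDerivOp_eq_iteratedFDeriv, iteratedLineDerivOp_slice]
  exact iteratedLineDerivOp_integral μ H φ h m x

variable [SecondCountableTopology Y]

theorem integrable_weightedDeriv_slice (H : 𝓢(X × Y, ℂ)) (k n : ℕ) :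
    Integrable (fun y => weightedDeriv k n (slice H y)) μ := by
  obtain ⟨C, hC0, hC⟩ := seminorm_slice_le H k n μ.integrablePower
  refine ((μ.integrable_pow_neg_integrablePower).const_mul C).mono'
    ((continuous_weightedDeriv k n).comp (continuous_slice H)).aestronglyMeasurable
    (ae_of_all _ fun y => (norm_weightedDeriv_le k n _).trans (hC y))

theorem weightedDeriv_integral (H : 𝓢(X × Y, ℂ)) (φ : 𝓢(X, ℂ))
    (h : ∀ x, φ x = ∫ y, H (x, y) ∂μ) (k n : ℕ) :
    weightedDeriv k n φ = ∫ y, weightedDeriv k n (slice H y) ∂μ := by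
  have hi := integrable_weightedDeriv_slice μ H k n
  ext x m
  have h1 := ((ContinuousMultilinearMap.apply ℝ (fun _ : Fin n => X) ℂ m).comp
    (BoundedContinuousFunction.evalCLM ℝ x)).integral_comp_comm hi
  simp only [ContinuousLinearMap.comp_apply, BoundedContinuousFunction.evalCLM_apply,
    ContinuousMultilinearMap.apply_apply, weightedDeriv_apply,
    _root_.smul_apply] at h1
  rw [← h1, integral_smul, weightedDeriv_apply, _root_.smul_apply,
    iteratedFDeriv_integral_slice μ H φ h]

/-- Through the Banach space factorization of $u$, the integral becomes a Bochner integral of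
weighted derivatives, and a continuous linear form commutes with it. -/
theorem integral_apply_slice (H : 𝓢(X × Y, ℂ)) (φ : 𝓢(X, ℂ))
    (h : ∀ x, φ x = ∫ y, H (x, y) ∂μ) (u : 𝓢'(X, ℂ)) :
    u φ = ∫ y, u (slice H y) ∂μ := by
  obtain ⟨s, L, hL⟩ := exists_extension u
  simp_rw [hL]
  rw [L.integral_comp_comm (Integrable.of_eval fun i => integrable_weightedDeriv_slice μ H _ _)]
  congr 1
  funext i
  rw [eval_integral fun i => integrable_weightedDeriv_slice μ H _ _]
  exact weightedDeriv_integral μ H φ h _ _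

end Exchange

/-! ### Fourier characters, Schwartz kernels and dual windows. -/

/-- The Euclidean space `ℝ^d`. -/
abbrev Space (d : ℕ) := EuclideanSpace ℝ (Fin d)

variable {d : ℕ}

theorem norm_fourierExp (w t : Space d) : ‖fourierExp w t‖ = 1 := by
  have : fourierExp w t = Complex.exp ((-(2 * Real.pi * inner ℝ t w) : ℝ) * Complex.I) := by
    simp [fourierExp]
  rw [this, Complex.norm_exp_ofReal_mul_I]

theorem fourierExp_comm (w t : Space d) : fourierExp w t = fourierExp t w := by
  rw [fourierExp, fourierExp, real_inner_comm]

theorem continuous_fourierExp : Continuous fun z : Space d × Space d => fourierExp z.1 z.2 := by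
  unfold fourierExp
  fun_prop

theorem fourierExp_add (w w' t : Space d) :
    fourierExp (w + w') t = fourierExp w t * fourierExp w' t := by
  simp only [fourierExp, ← Complex.exp_add, inner_add_right]
  congr 1
  push_cast
  ring

theorem fourierExp_neg (w t : Space d) :
    fourierExp (-w) t = (starRingEnd ℂ) (fourierExp w t) := by
  simp only [fourierExp, ← Complex.exp_conj, inner_neg_right, map_mul, map_neg, Complex.conj_ofReal,
    Complex.conj_I]
  push_cast
  ring_nf

theorem fourier_eq_integral (f : Space d → ℂ) (w : Space d) :
    𝓕 f w = ∫ t, fourierExp w t * f t := by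
  rw [Real.fourier_eq']
  congr 1
  funext t
  rw [fourierExp, smul_eq_mul]
  congr 2
  push_cast
  ring

theorem fourierInv_eq_integral (f : Space d → ℂ) (t : Space d) :
    𝓕⁻ f t = ∫ w, fourierExp (-w) t * f w := by
  rw [Real.fourierInv_eq_fourier_neg, fourier_eq_integral]
  congr 1
  funext w
  rw [fourierExp_comm, fourierExp, fourierExp]
  simp

theorem hasTemperateGrowth_phase {Z : Type*} [NormedAddCommGroup Z] [NormedSpace ℝ Z]
    (A B : Z →L[ℝ] Space d) :
    (fun z => fourierExp (A z) (B z)).HasTemperateGrowth := by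
  have h1 : (fun z => inner ℝ (B z) (A z)).HasTemperateGrowth :=
    (innerSL ℝ).bilinear_hasTemperateGrowth B.hasTemperateGrowth A.hasTemperateGrowth
  exact hasTemperateGrowth_exp_mul_I.comp
    ((Function.HasTemperateGrowth.const (2 * Real.pi)).mul h1)

section SchwartzAlgebra

variable {X : Type*} [NormedAddCommGroup X] [NormedSpace ℝ X]

/-- The pointwise product of two Schwartz functions. -/
noncomputable def prod (φ ψ : 𝓢(X, ℂ)) : 𝓢(X, ℂ) := SchwartzMap.smulLeftCLM ℂ φ ψ

@[simp]
theorem prod_apply (φ ψ : 𝓢(X, ℂ)) (x : X) : prod φ ψ x = φ x * ψ x := by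
  simp [prod, SchwartzMap.smulLeftCLM_apply_apply φ.hasTemperateGrowth]

/-- The complex conjugate of a Schwartz function. -/
noncomputable def conjugate (φ : 𝓢(X, ℂ)) : 𝓢(X, ℂ) :=
  SchwartzMap.postcompCLM (𝕜 := ℝ) (Complex.conjCLE : ℂ →L[ℝ] ℂ) φ

@[simp]
theorem conjugate_apply (φ : 𝓢(X, ℂ)) (x : X) : conjugate φ x = (starRingEnd ℂ) (φ x) := by
  simp [conjugate]

/-- The translate `t ↦ φ (t - x)`. -/
noncomputable def translate (φ : 𝓢(X, ℂ)) (x : X) : 𝓢(X, ℂ) :=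
  SchwartzMap.compSubConstCLM ℂ x φ

@[simp]
theorem translate_apply (φ : 𝓢(X, ℂ)) (x t : X) : translate φ x t = φ (t - x) := by
  simp [translate]

theorem exists_schwartz_eventuallyEq_one [FiniteDimensional ℝ X] (x : X) :
    ∃ φ : 𝓢(X, ℂ), ∀ᶠ y in 𝓝 x, φ y = 1 := by
  let b : ContDiffBump x := ⟨1, 2, one_pos, one_lt_two⟩
  have hc : HasCompactSupport fun y => (b y : ℂ) :=
    b.hasCompactSupport.comp_left Complex.ofReal_zero
  refine ⟨hc.toSchwartzMap (Complex.ofRealCLM.contDiff.comp b.contDiff), ?_⟩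
  filter_upwards [b.eventuallyEq_one] with y hy
  change ((b y : ℝ) : ℂ) = 1
  simp [hy]

end SchwartzAlgebra

/-- The dual window is $\gamma=\bar g/\|g\|_2^2$. -/
theorem exists_integral_mul_eq_one {g : 𝓢(Space d, ℂ)} (hg : g ≠ 0) :
    ∃ γ : 𝓢(Space d, ℂ), ∫ t, g t * γ t = 1 := by
  have hi : Integrable (fun t => ‖g t‖ ^ 2) := by
    refine (prod g (conjugate g)).integrable.norm.congr (ae_of_all _ fun t => ?_)
    simp [sq]
  have h0 : ∫ t, ‖g t‖ ^ 2 ≠ 0 := fun h => by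
    rw [integral_eq_zero_iff_of_nonneg (fun t => by positivity) hi] at h
    have h2 := (Continuous.ae_eq_iff_eq volume (by fun_prop) continuous_zero).1 h
    exact hg (SchwartzMap.ext fun t => by simpa using congrFun h2 t)
  refine ⟨((∫ t, ‖g t‖ ^ 2 : ℝ) : ℂ)⁻¹ • conjugate g, ?_⟩
  have e : ∀ t, g t * (((∫ t, ‖g t‖ ^ 2 : ℝ) : ℂ)⁻¹ • conjugate g) t =
      ((∫ t, ‖g t‖ ^ 2 : ℝ) : ℂ)⁻¹ * ((‖g t‖ ^ 2 : ℝ) : ℂ) := fun t => by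
    have : g t * (starRingEnd ℂ) (g t) = ((‖g t‖ ^ 2 : ℝ) : ℂ) := by
      rw [Complex.mul_conj, Complex.normSq_eq_norm_sq]
    simp only [_root_.smul_apply, conjugate_apply, smul_eq_mul, ← this]
    ring
  simp_rw [e]
  rw [integral_const_mul, integral_complex_ofReal, inv_mul_cancel₀ (by exact_mod_cast h0)]

/-- The Schwartz function `(t, y) ↦ ψ y * η (t - y)`. -/
noncomputable def shear (ψ η : 𝓢(Space d, ℂ)) : 𝓢(Space d × Space d, ℂ) :=
  SchwartzMap.compCLMOfContinuousLinearEquiv ℝ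
    (ContinuousLinearEquiv.ofBijective
      (((ContinuousLinearMap.fst ℝ (Space d) (Space d)).prod
        (ContinuousLinearMap.fst ℝ (Space d) (Space d) -
          ContinuousLinearMap.snd ℝ (Space d) (Space d))))
      (LinearMap.ker_eq_bot.2 fun z z' h => by
        simp only [ContinuousLinearMap.coe_coe, ContinuousLinearMap.prod_apply,
          ContinuousLinearMap.coe_fst', _root_.sub_apply,
          ContinuousLinearMap.coe_snd', Prod.mk.injEq] at h
        exact Prod.ext h.1 (by simpa [h.1] using h.2))
      (LinearMap.range_eq_top.2 fun z => ⟨(z.1, z.1 - z.2), by simp⟩))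
    (tensor ψ η)

@[simp]
theorem shear_apply (ψ η : 𝓢(Space d, ℂ)) (z : Space d × Space d) :
    shear ψ η z = ψ z.1 * η (z.1 - z.2) := by
  simp [shear, tensor_apply]

/-- The Schwartz function `(t, w) ↦ exp (-2 π i t · w) φ t * ψ w`. -/
noncomputable def fourierKernel (φ ψ : 𝓢(Space d, ℂ)) : 𝓢(Space d × Space d, ℂ) :=
  SchwartzMap.smulLeftCLM ℂ (fun z : Space d × Space d => fourierExp
    (ContinuousLinearMap.snd ℝ (Space d) (Space d) z)
    (ContinuousLinearMap.fst ℝ (Space d) (Space d) z)) (tensor φ ψ)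

@[simp]
theorem fourierKernel_apply (φ ψ : 𝓢(Space d, ℂ)) (z : Space d × Space d) :
    fourierKernel φ ψ z = fourierExp z.2 z.1 * (φ z.1 * ψ z.2) := by
  rw [fourierKernel, SchwartzMap.smulLeftCLM_apply_apply (hasTemperateGrowth_phase _ _)]
  simp [tensor_apply]

/-- The Schwartz function `(t, (x, w)) ↦ exp (-2 π i t · w) g (t - x) * ψ (x, w)`. -/
noncomputable def stftKernel (g : 𝓢(Space d, ℂ)) (ψ : 𝓢(Space d × Space d, ℂ)) :
    𝓢(Space d × (Space d × Space d), ℂ) :=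
  SchwartzMap.smulLeftCLM ℂ (fun z : Space d × (Space d × Space d) => fourierExp
    ((ContinuousLinearMap.snd ℝ (Space d) (Space d)).comp (ContinuousLinearMap.snd ℝ _ _) z)
    (ContinuousLinearMap.fst ℝ (Space d) (Space d × Space d) z))
  (SchwartzMap.compCLMOfContinuousLinearEquiv ℝ
    (ContinuousLinearEquiv.ofBijective
      (((ContinuousLinearMap.fst ℝ (Space d) (Space d × Space d) -
          (ContinuousLinearMap.fst ℝ (Space d) (Space d)).comp
            (ContinuousLinearMap.snd ℝ (Space d) (Space d × Space d)))).prod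
        (ContinuousLinearMap.snd ℝ (Space d) (Space d × Space d)))
      (LinearMap.ker_eq_bot.2 fun z z' h => by
        simp only [ContinuousLinearMap.coe_coe, ContinuousLinearMap.prod_apply,
          ContinuousLinearMap.coe_fst', _root_.sub_apply,
          ContinuousLinearMap.comp_apply,
          ContinuousLinearMap.coe_snd', Prod.mk.injEq] at h
        exact Prod.ext (by simpa [h.2] using h.1) h.2)
      (LinearMap.range_eq_top.2 fun z => ⟨(z.1 + z.2.1, z.2), by simp⟩))
    (tensor g ψ))

theorem stftKernel_apply (g : 𝓢(Space d, ℂ)) (ψ : 𝓢(Space d × Space d, ℂ))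
    (z : Space d × (Space d × Space d)) :
    stftKernel g ψ z = fourierExp z.2.2 z.1 * (g (z.1 - z.2.1) * ψ z.2) := by
  rw [stftKernel, SchwartzMap.smulLeftCLM_apply_apply (hasTemperateGrowth_phase _ _)]
  simp [tensor_apply]

/-! ### Localizations of a distribution, and gluing them to a function. -/

theorem continuous_localFourier (g : 𝓢(Space d, ℂ)) (u : 𝓢'(Space d, ℂ)) :
    Continuous fun z : Space d × Space d => localFourier g u z.1 z.2 := by
  rw [continuous_iff_continuousAt]
  intro z
  -- The family of time-frequency shifts does not decay in $(x,w)$; a cutoff equal to 1 near $z$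
  -- turns it locally into slices of a Schwartz function.
  obtain ⟨ψ, hψ⟩ := exists_schwartz_eventuallyEq_one z
  have hc : Continuous fun z => u (slice (stftKernel g ψ) z) :=
    u.continuous.comp (continuous_slice _)
  refine hc.continuousAt.congr ?_
  filter_upwards [hψ] with y hy
  rw [localFourier]
  congr 1
  ext t
  simp [stftKernel_apply, timeFreqShift_apply, hy]

/-- This confirms that `localFourier g u x` is the distributional Fourier transform of $u\cdot
T_xg$: write $\mathcal F\psi$ as an integral and move $u$ inside. -/
theorem apply_prod_fourier (g : 𝓢(Space d, ℂ)) (u : 𝓢'(Space d, ℂ)) (x : Space d)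
    (ψ : 𝓢(Space d, ℂ)) :
    u (prod (translate g x) (𝓕 ψ)) = ∫ w, ψ w * localFourier g u x w := by
  rw [integral_apply_slice volume (fourierKernel (translate g x) ψ) _ _ u]
  · congr 1
    funext w
    have : slice (fourierKernel (translate g x) ψ) w = ψ w • timeFreqShift g x w := by
      ext t
      simp [timeFreqShift_apply]
      ring
    rw [this, map_smul, smul_eq_mul, localFourier]
  · intro t
    simp only [prod_apply, translate_apply, fourierKernel_apply, SchwartzMap.fourier_coe]
    rw [fourier_eq_integral, ← integral_const_mul]
    congr 1
    funext w
    rw [fourierExp_comm]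
    ring

theorem integral_mul_fourierInv {V : Space d → ℂ} (hV : Integrable V) (χ : 𝓢(Space d, ℂ)) :
    ∫ w, (𝓕⁻ χ) w * V w = ∫ t, χ t * 𝓕⁻ V t := by
  -- The bilinear form is $-\langle\cdot,\cdot\rangle$, so the self-adjointness of this Fourier
  -- integral is that of the inverse transform.
  have h := VectorFourier.integral_fourierIntegral_smul_eq_flip (e := Real.fourierChar)
    (L := -innerₗ (Space d)) (μ := volume) (ν := volume) Real.continuous_fourierChar
    (by
      have : Continuous fun p : Space d × Space d => -inner ℝ p.1 p.2 := by fun_prop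
      simpa using this) χ.integrable hV
  have h1 : ∀ (f : Space d → ℂ) w, VectorFourier.fourierIntegral Real.fourierChar volume
      (-innerₗ (Space d)) f w = 𝓕⁻ f w := fun f w => by
    simp [VectorFourier.fourierIntegral, Real.fourierInv_eq]
  have h2 : (-innerₗ (Space d)).flip = -innerₗ (Space d) := by
    ext; simp [real_inner_comm]
  simp only [h2, h1, smul_eq_mul] at h
  rw [SchwartzMap.fourierInv_coe]
  exact h

theorem apply_prod_translate {g : 𝓢(Space d, ℂ)} {u : 𝓢'(Space d, ℂ)} {x : Space d}
    (h : Integrable (localFourier g u x)) (χ : 𝓢(Space d, ℂ)) :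
    u (prod (translate g x) χ) = ∫ t, χ t * 𝓕⁻ (localFourier g u x) t := by
  rw [← integral_mul_fourierInv h, ← apply_prod_fourier, FourierTransform.fourier_fourierInv_eq]

theorem continuous_fourierInv {V : Space d → ℂ} (hV : Integrable V) : Continuous (𝓕⁻ V) := by
  rw [Real.fourierInv_eq_fourier_comp_neg]
  exact VectorFourier.fourierIntegral_continuous Real.continuous_fourierChar
    (by exact continuous_inner) hV.comp_neg

theorem enorm_fourierInv_le (V : Space d → ℂ) (t : Space d) : ‖𝓕⁻ V t‖ₑ ≤ ∫⁻ w, ‖V w‖ₑ := by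
  rw [fourierInv_eq_integral]
  refine (enorm_integral_le_lintegral_enorm _).trans (le_of_eq ?_)
  congr 1
  funext w
  rw [enorm_mul, ← ofReal_norm, norm_fourierExp, ENNReal.ofReal_one, one_mul]

theorem ae_eq_of_forall_integral_eq {f f' : Space d → ℂ}
    (hf : ∀ φ : 𝓢(Space d, ℂ), Integrable fun x => φ x * f x)
    (hf' : ∀ φ : 𝓢(Space d, ℂ), Integrable fun x => φ x * f' x)
    (h : ∀ φ : 𝓢(Space d, ℂ), ∫ x, φ x * f x = ∫ x, φ x * f' x) : f =ᵐ[volume] f' := by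
  have hl : ∀ f : Space d → ℂ, (∀ φ : 𝓢(Space d, ℂ), Integrable fun x => φ x * f x) →
      LocallyIntegrable f := fun f hf x => by
    obtain ⟨φ, hφ⟩ := exists_schwartz_eventuallyEq_one x
    obtain ⟨U, hU, hUo, hxU⟩ := eventually_nhds_iff.1 hφ
    refine ⟨U, hUo.mem_nhds hxU, ?_⟩
    refine ((hf φ).integrableOn (s := U)).congr_fun (fun y hy => ?_) hUo.measurableSet
    simp [hU y hy]
  refine ae_eq_of_integral_contDiff_smul_eq (hl f hf) (hl f' hf') fun g hg hgs => ?_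
  have hc : HasCompactSupport fun y => (g y : ℂ) := hgs.comp_left Complex.ofReal_zero
  exact h (hc.toSchwartzMap (Complex.ofRealCLM.contDiff.comp hg))

/-- The `L^1` norm in `w` of `𝓕 (u · T_x g) (w)`. -/
noncomputable def localNorm (g : 𝓢(Space d, ℂ)) (u : 𝓢'(Space d, ℂ)) (x : Space d) : ℝ≥0∞ :=
  ∫⁻ w, ‖localFourier g u x w‖ₑ

theorem amalgamNorm_one_eq (g : 𝓢(Space d, ℂ)) (p : ℝ≥0∞) (u : 𝓢'(Space d, ℂ)) :
    amalgamNorm g p 1 u = eLpNorm (localNorm g u) p volume := by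
  simp only [amalgamNorm, eLpNorm_one_eq_lintegral_enorm]
  rfl

theorem measurable_localNorm (g : 𝓢(Space d, ℂ)) (u : 𝓢'(Space d, ℂ)) :
    Measurable (localNorm g u) :=
  (continuous_localFourier g u).enorm.measurable.lintegral_prod_right'

theorem ae_lt_top_of_eLpNorm_lt_top {N : Space d → ℝ≥0∞} (hN : Measurable N) {p : ℝ≥0∞}
    (hp : p ≠ 0) (h : eLpNorm N p volume < ∞) : ∀ᵐ x, N x < ∞ := by
  rcases eq_or_ne p ∞ with rfl | hp'
  · rw [eLpNorm_exponent_top] at h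
    filter_upwards [enorm_ae_le_eLpNormEssSup N volume] with x hx
    exact hx.trans_lt h
  · rw [eLpNorm_lt_top_iff_lintegral_rpow_enorm_lt_top hp hp'] at h
    have h0 := ENNReal.toReal_pos hp hp'
    filter_upwards [ae_lt_top (by simpa using hN.pow_const p.toReal) h.ne] with x hx
    by_contra hx'
    simp only [not_lt, top_le_iff] at hx'
    simp [hx', ENNReal.top_rpow_of_pos h0] at hx

theorem integrable_localFourier {g : 𝓢(Space d, ℂ)} {u : 𝓢'(Space d, ℂ)} {x : Space d}
    (h : localNorm g u x < ∞) : Integrable (localFourier g u x) :=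
  ⟨((continuous_localFourier g u).comp (Continuous.prodMk_right x)).aestronglyMeasurable, h⟩

theorem integrable_mul_of_bounded {f : Space d → ℂ} (hf : AEStronglyMeasurable f) {M : ℝ}
    (hM : ∀ᵐ x, ‖f x‖ ≤ M) (φ : 𝓢(Space d, ℂ)) : Integrable fun x => φ x * f x :=
  φ.integrable.mul_bdd hf hM

theorem norm_fourierInv_localFourier_le {g : 𝓢(Space d, ℂ)} {u : 𝓢'(Space d, ℂ)} {x : Space d}
    (h : localNorm g u x < ∞) (t : Space d) :
    ‖𝓕⁻ (localFourier g u x) t‖ ≤ (localNorm g u x).toReal := by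
  have := ENNReal.toReal_mono h.ne (enorm_fourierInv_le (localFourier g u x) t)
  simpa using this

/-- Both sides represent the distribution $u\cdot T_xg\cdot T_yg$, so they agree almost everywhere,
hence everywhere by continuity. -/
theorem fourierInv_localFourier_compat {g : 𝓢(Space d, ℂ)} {u : 𝓢'(Space d, ℂ)} {x y : Space d}
    (hx : localNorm g u x < ∞) (hy : localNorm g u y < ∞) (t : Space d) :
    𝓕⁻ (localFourier g u x) t * g (t - y) = 𝓕⁻ (localFourier g u y) t * g (t - x) := by
  have hcx := continuous_fourierInv (integrable_localFourier hx)
  have hcy := continuous_fourierInv (integrable_localFourier hy)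
  have hbx := fun χ => integrable_mul_of_bounded hcx.aestronglyMeasurable
    (ae_of_all _ (norm_fourierInv_localFourier_le hx)) χ
  have hby := fun χ => integrable_mul_of_bounded hcy.aestronglyMeasurable
    (ae_of_all _ (norm_fourierInv_localFourier_le hy)) χ
  have hg : ∀ z : Space d, Continuous fun t => g (t - z) := fun z => by fun_prop
  refine congrFun ((Continuous.ae_eq_iff_eq volume (hcx.mul (hg y)) (hcy.mul (hg x))).1
    (ae_eq_of_forall_integral_eq (fun φ => ?_) (fun φ => ?_) fun φ => ?_)) t
  · refine (hbx (prod (translate g y) φ)).congr (ae_of_all _ fun t => ?_)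
    simp; ring
  · refine (hby (prod (translate g x) φ)).congr (ae_of_all _ fun t => ?_)
    simp; ring
  · have h1 := apply_prod_translate (integrable_localFourier hx) (prod (translate g y) φ)
    have h2 := apply_prod_translate (integrable_localFourier hy) (prod (translate g x) φ)
    have h3 : prod (translate g x) (prod (translate g y) φ) =
        prod (translate g y) (prod (translate g x) φ) := by
      ext t; simp; ring
    rw [h3, h2] at h1
    refine (Eq.trans ?_ h1.symm).trans ?_ <;>
    · congr 1
      funext t
      simp
      ring

/-- Since $\int g(t-x)\gamma(t-x)\,dx=1$ for every $t$, the products $T_xg\,T_x\gamma$ form a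
continuous partition of unity. -/
theorem integral_apply_translate (u : 𝓢'(Space d, ℂ)) {g γ : 𝓢(Space d, ℂ)}
    (h : ∫ t, g t * γ t = 1) (χ : 𝓢(Space d, ℂ)) :
    u χ = ∫ x, u (prod (translate g x) (prod (translate γ x) χ)) := by
  rw [integral_apply_slice volume (shear χ (prod g γ)) χ _ u]
  · congr 1
    funext x
    congr 1
    ext t
    simp
    ring
  · intro t
    simp only [shear_apply, prod_apply]
    rw [integral_const_mul, integral_sub_left_eq_self (fun s => g s * γ s) volume t, h, mul_one]

theorem exists_ball_norm_ge {g : 𝓢(Space d, ℂ)} (hg : g ≠ 0) :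
    ∃ (t₀ : Space d) (r c : ℝ), 0 < r ∧ 0 < c ∧ ∀ t ∈ Metric.ball t₀ r, c ≤ ‖g t‖ := by
  obtain ⟨t₀, ht₀⟩ : ∃ t, g t ≠ 0 := by
    by_contra! h
    exact hg (SchwartzMap.ext h)
  have hpos : 0 < ‖g t₀‖ := norm_pos_iff.2 ht₀
  have : ∀ᶠ t in 𝓝 t₀, ‖g t₀‖ / 2 < ‖g t‖ :=
    g.continuous.norm.continuousAt.eventually (lt_mem_nhds (half_lt_self hpos))
  obtain ⟨r, hr, hball⟩ := Metric.eventually_nhds_iff_ball.1 this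
  exact ⟨t₀, r, ‖g t₀‖ / 2, hr, half_pos hpos, fun t ht => (hball t ht).le⟩

/-- A distribution whose localizations have integrable Fourier transforms for almost every
position of the window is a continuous function. -/
theorem exists_continuous_fourierInv_localFourier {g : 𝓢(Space d, ℂ)} (hg : g ≠ 0)
    {u : 𝓢'(Space d, ℂ)} (hu : ∀ᵐ x, localNorm g u x < ∞) :
    ∃ f : Space d → ℂ, Continuous f ∧ ∀ x, localNorm g u x < ∞ →
      ∀ t, 𝓕⁻ (localFourier g u x) t = f t * g (t - x) := by
  obtain ⟨t₀, r, c, hr, hc, hball⟩ := exists_ball_norm_ge hg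
  -- The $x$ with $g(t-x)\ne0$ contain a ball, which the null set of bad positions cannot cover.
  have hex : ∀ t : Space d, ∃ x, localNorm g u x < ∞ ∧ g (t - x) ≠ 0 := fun t => by
    have hpos : volume (Metric.ball (t - t₀) r) ≠ 0 := (Metric.measure_ball_pos _ _ hr).ne'
    obtain ⟨x, hx, hxu⟩ := (frequently_ae_mem_iff.2 hpos).and_eventually hu |>.exists
    refine ⟨x, hxu, norm_pos_iff.1 (hc.trans_le (hball _ ?_))⟩
    rw [Metric.mem_ball, dist_eq_norm] at hx ⊢
    rwa [show t - x - t₀ = -(x - (t - t₀)) by abel, norm_neg]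
  choose X hX hgX using hex
  have key : ∀ x, localNorm g u x < ∞ → ∀ t, 𝓕⁻ (localFourier g u x) t =
      𝓕⁻ (localFourier g u (X t)) t / g (t - X t) * g (t - x) := fun x hx t => by
    rw [div_mul_eq_mul_div, eq_div_iff (hgX t)]
    exact fourierInv_localFourier_compat hx (hX t) t
  refine ⟨fun t => 𝓕⁻ (localFourier g u (X t)) t / g (t - X t), ?_, key⟩
  rw [continuous_iff_continuousAt]
  intro t
  have hcg : Continuous fun s => g (s - X t) := by fun_prop
  -- The choice `X` need not be continuous, but near $t$ the single position `X t` computes $f$.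
  have hq : ContinuousAt (fun s => 𝓕⁻ (localFourier g u (X t)) s / g (s - X t)) t :=
    (continuous_fourierInv (integrable_localFourier (hX t))).continuousAt.div
      hcg.continuousAt (hgX t)
  refine hq.congr ?_
  filter_upwards [hcg.continuousAt.eventually_ne (hgX t)] with s hs
  rw [key (X t) (hX t) s, mul_div_assoc, div_self hs, mul_one]

/-- For $x$ in the ball of radius $r$ about $t-t_0$, $c|f(t)|\le$ `localNorm g u x`. The $L^p$ norm
of this constant over the ball is $c|f(t)|$ times a factor independent of $t$. -/
theorem exists_forall_norm_le {g : 𝓢(Space d, ℂ)} (hg : g ≠ 0) {u : 𝓢'(Space d, ℂ)}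
    {p : ℝ≥0∞} (hp : p ≠ 0) (hu : eLpNorm (localNorm g u) p volume < ∞) {f : Space d → ℂ}
    (hf : ∀ x, localNorm g u x < ∞ →
      ∀ t, 𝓕⁻ (localFourier g u x) t = f t * g (t - x)) :
    ∃ M : ℝ, ∀ t, ‖f t‖ ≤ M := by
  obtain ⟨t₀, r, c, hr, hc, hball⟩ := exists_ball_norm_ge hg
  have hv0 : volume (Metric.ball (0 : Space d) r) ≠ 0 := (Metric.measure_ball_pos _ _ hr).ne'
  have hvt : volume (Metric.ball (0 : Space d) r) ≠ ∞ := measure_ball_lt_top.ne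
  -- For $p=\infty$, `p.toReal = 0` and `1 / 0 = 0`, so $m=1$, the right factor for the essential
  -- supremum.
  set m : ℝ≥0∞ := volume (Metric.ball (0 : Space d) r) ^ (1 / p.toReal)
  have hm0 : m ≠ 0 := (ENNReal.rpow_pos (pos_iff_ne_zero.2 hv0) hvt).ne'
  have hle : ∀ t, ‖(c : ℂ) * f t‖ₑ * m ≤ eLpNorm (localNorm g u) p volume := fun t => by
    have e : volume (Metric.ball (t - t₀) r) = volume (Metric.ball (0 : Space d) r) :=
      Measure.addHaar_ball_center _ _ _
    rw [← show volume (Metric.ball (t - t₀) r) ^ (1 / p.toReal) = m by rw [e],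
      ← eLpNorm_indicator_const' Metric.isOpen_ball.measurableSet (by rwa [e]) hp]
    refine eLpNorm_mono_enorm fun x => ?_
    by_cases hx : x ∈ Metric.ball (t - t₀) r
    · rw [Set.indicator_of_mem hx, enorm_eq_self]
      rcases lt_or_ge (localNorm g u x) ∞ with h | h
      · refine le_trans ?_ (enorm_fourierInv_le (localFourier g u x) t)
        rw [hf x h t, mul_comm, enorm_mul, enorm_mul]
        gcongr
        rw [← ofReal_norm, ← ofReal_norm]
        refine ENNReal.ofReal_le_ofReal ?_
        rw [Complex.norm_real, Real.norm_of_nonneg hc.le]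
        refine hball _ ?_
        rw [Metric.mem_ball, dist_eq_norm] at hx ⊢
        rwa [show t - x - t₀ = -(x - (t - t₀)) by abel, norm_neg]
      · rw [top_le_iff.1 h]
        exact le_top
    · simp [Set.indicator_of_notMem hx]
  refine ⟨(eLpNorm (localNorm g u) p volume / m).toReal / c, fun t => ?_⟩
  rw [le_div_iff₀ hc]
  have h1 : ‖(c : ℂ) * f t‖ₑ ≤ eLpNorm (localNorm g u) p volume / m :=
    (ENNReal.le_div_iff_mul_le (Or.inl hm0) (Or.inr hu.ne)).2 (hle t)
  have h2 := ENNReal.toReal_mono (ENNReal.div_lt_top hu.ne hm0).ne h1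
  rw [toReal_enorm, norm_mul, Complex.norm_real, Real.norm_of_nonneg hc.le] at h2
  linarith

/-- Averaging over windows recovers $u\chi$ from its localizations; Fubini and $\int g\gamma=1$ then
remove the windows. -/
theorem isGivenBy_of_fourierInv_localFourier {g : 𝓢(Space d, ℂ)} (hg : g ≠ 0)
    {u : 𝓢'(Space d, ℂ)} (hu : ∀ᵐ x, localNorm g u x < ∞) {f : Space d → ℂ}
    (hfc : Continuous f) {M : ℝ} (hM : ∀ t, ‖f t‖ ≤ M)
    (hf : ∀ x, localNorm g u x < ∞ →
      ∀ t, 𝓕⁻ (localFourier g u x) t = f t * g (t - x)) :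
    IsGivenBy u f := by
  intro χ
  refine ⟨integrable_mul_of_bounded hfc.aestronglyMeasurable (ae_of_all _ hM) χ, ?_⟩
  obtain ⟨γ, hγ⟩ := exists_integral_mul_eq_one hg
  rw [integral_apply_translate u hγ]
  have e1 : ∀ᵐ x, u (prod (translate g x) (prod (translate γ x) χ)) =
      ∫ t, shear χ (prod g γ) (t, x) * f t := by
    filter_upwards [hu] with x hx
    rw [apply_prod_translate (integrable_localFourier hx)]
    congr 1
    funext t
    rw [hf x hx]
    simp
    ring
  rw [integral_congr_ae e1, integral_integral_swap]
  · congr 1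
    funext t
    simp only [shear_apply, prod_apply]
    rw [integral_mul_const, integral_const_mul,
      integral_sub_left_eq_self (fun s => g s * γ s) volume t, hγ, mul_one]
  · have h1 : Integrable (shear χ (prod g γ)) ((volume : Measure (Space d)).prod volume) := by
      have : ((volume : Measure (Space d)).prod (volume : Measure (Space d))).HasTemperateGrowth :=
        Measure.IsAddHaarMeasure.instHasTemperateGrowth
      exact (shear χ (prod g γ)).integrable
    have h2 : Integrable (fun z : Space d × Space d => shear χ (prod g γ) (z.1, z.2) * f z.1)
        ((volume : Measure (Space d)).prod volume) :=
      h1.mul_bdd (hfc.comp continuous_fst).aestronglyMeasurable (ae_of_all _ fun z => hM z.1)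
    exact h2.swap

/-- Elements of `W^{p,1}` are bounded continuous functions. -/
theorem exists_isGivenBy {g : 𝓢(Space d, ℂ)} (hg : g ≠ 0) {p : ℝ≥0∞} (hp : p ≠ 0)
    {u : 𝓢'(Space d, ℂ)} (hu : u ∈ amalgamSpace g p 1) :
    ∃ f : Space d → ℂ, Continuous f ∧ (∃ M : ℝ, ∀ x, ‖f x‖ ≤ M) ∧ IsGivenBy u f := by
  have hu' : eLpNorm (localNorm g u) p volume < ∞ := by rwa [← amalgamNorm_one_eq]
  have hae := ae_lt_top_of_eLpNorm_lt_top (measurable_localNorm g u) hp hu'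
  obtain ⟨f, hfc, hf⟩ := exists_continuous_fourierInv_localFourier hg hae
  obtain ⟨M, hM⟩ := exists_forall_norm_le hg hp hu' hf
  exact ⟨f, hfc, ⟨M, hM⟩, isGivenBy_of_fourierInv_localFourier hg hae hfc hM hf⟩

/-! ### Minkowski, Hölder and Young inequalities for functions with values in $[0,\infty]$. -/

section LpNorms

variable {α : Type*} [MeasurableSpace α] {μ : Measure α} {p : ℝ≥0∞}

theorem eLpNorm_ennreal_const_mul_le (c : ℝ≥0) (N : α → ℝ≥0∞) :
    eLpNorm (fun x => c * N x) p μ ≤ c * eLpNorm N p μ := by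
  rcases eq_or_ne p 0 with rfl | h0
  · simp
  rcases eq_or_ne p ∞ with rfl | hp
  · simp only [eLpNorm_exponent_top, eLpNormEssSup, enorm_eq_self]
    exact ENNReal.essSup_const_mul.le
  · have hpos := ENNReal.toReal_pos h0 hp
    simp only [eLpNorm_eq_lintegral_rpow_enorm_toReal h0 hp, enorm_eq_self,
      ENNReal.mul_rpow_of_nonneg _ _ hpos.le]
    rw [lintegral_const_mul' _ _ (ENNReal.rpow_ne_top_of_nonneg hpos.le ENNReal.coe_ne_top),
      ENNReal.mul_rpow_of_nonneg _ _ (by positivity), ← ENNReal.rpow_mul,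
      mul_one_div_cancel hpos.ne', ENNReal.rpow_one]

theorem ae_le_eLpNorm_top (N : α → ℝ≥0∞) : ∀ᵐ x ∂μ, N x ≤ eLpNorm N ∞ μ := by
  rw [eLpNorm_exponent_top]
  exact enorm_ae_le_eLpNormEssSup N μ

/-- For finite $p$, monotone convergence over finite partial sums reduces this to the usual
Minkowski inequality. -/
theorem eLpNorm_tsum_le {ι : Type*} [Countable ι] {N : ι → α → ℝ≥0∞}
    (hN : ∀ i, Measurable (N i)) (hp : 1 ≤ p) :
    eLpNorm (fun x => ∑' i, N i x) p μ ≤ ∑' i, eLpNorm (N i) p μ := by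
  rcases eq_or_ne p ∞ with rfl | hp'
  · have h : ∀ᵐ x ∂μ, ∀ i, N i x ≤ eLpNorm (N i) ∞ μ := ae_all_iff.2 fun i => ae_le_eLpNorm_top _
    rw [eLpNorm_exponent_top]
    refine eLpNormEssSup_le_of_ae_enorm_bound ?_
    filter_upwards [h] with x hx
    exact ENNReal.tsum_le_tsum hx
  · have h0 : p ≠ 0 := (one_pos.trans_le hp).ne'
    have hpos := ENNReal.toReal_pos h0 hp'
    rw [eLpNorm_eq_lintegral_rpow_enorm_toReal h0 hp', one_div, ENNReal.rpow_inv_le_iff hpos]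
    have e : ∀ x, ‖∑' i, N i x‖ₑ ^ p.toReal = ⨆ s : Finset ι, (∑ i ∈ s, N i x) ^ p.toReal :=
      fun x => by
        rw [enorm_eq_self, ENNReal.tsum_eq_iSup_sum]
        exact (ENNReal.orderIsoRpow p.toReal hpos).map_iSup _
    simp_rw [e]
    rw [lintegral_iSup_directed]
    · refine iSup_le fun s => ?_
      rw [← ENNReal.rpow_inv_le_iff hpos]
      have h1 := eLpNorm_sum_le (μ := μ) (s := s) (f := N)
        (fun i _ => (hN i).aestronglyMeasurable) hp
      rw [eLpNorm_eq_lintegral_rpow_enorm_toReal h0 hp', one_div] at h1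
      simp only [enorm_eq_self, Finset.sum_apply] at h1
      exact h1.trans (ENNReal.sum_le_tsum s)
    · exact fun s => ((Finset.measurable_sum s fun i _ => hN i).pow_const _).aemeasurable
    · intro s t
      classical
      refine ⟨s ∪ t, fun x => ?_, fun x => ?_⟩ <;> dsimp only <;> gcongr
      · exact Finset.subset_union_left
      · exact Finset.subset_union_right

/-- Hölder's inequality for the measure with density `k`. -/
theorem lintegral_mul_rpow_le {N k : α → ℝ≥0∞} (hN : Measurable N) (hk : Measurable k)
    (hp : 1 ≤ p) (hp' : p ≠ ∞) :
    (∫⁻ y, N y * k y ∂μ) ^ p.toReal ≤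
      (∫⁻ y, N y ^ p.toReal * k y ∂μ) * (∫⁻ y, k y ∂μ) ^ (p.toReal - 1) := by
  have h0 : p ≠ 0 := (one_pos.trans_le hp).ne'
  have hpos := ENNReal.toReal_pos h0 hp'
  -- Comparison of the $L^1$ and $L^p$ norms for the measure $k\mu$, whose total mass is $\int k$.
  have h := eLpNorm_le_eLpNorm_mul_rpow_measure_univ (μ := μ.withDensity k) hp
    hN.aestronglyMeasurable
  rw [eLpNorm_one_eq_lintegral_enorm, eLpNorm_eq_lintegral_rpow_enorm_toReal h0 hp',
    withDensity_apply _ MeasurableSet.univ, setLIntegral_univ] at h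
  simp only [enorm_eq_self] at h
  rw [lintegral_withDensity_eq_lintegral_mul _ hk hN,
    lintegral_withDensity_eq_lintegral_mul _ hk (hN.pow_const _)] at h
  simp only [Pi.mul_apply, mul_comm (k _)] at h
  refine (ENNReal.rpow_le_rpow h hpos.le).trans (le_of_eq ?_)
  rw [ENNReal.mul_rpow_of_nonneg _ _ hpos.le, ← ENNReal.rpow_mul, ← ENNReal.rpow_mul,
    one_div_mul_cancel hpos.ne', ENNReal.rpow_one]
  congr 2
  simp only [ENNReal.toReal_one]
  field_simp

end LpNorms

section Convolution

variable {p : ℝ≥0∞} {N k : Space d → ℝ≥0∞}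

theorem lintegral_comp_sub_left (k : Space d → ℝ≥0∞) (y : Space d) :
    ∫⁻ x, k (y - x) = ∫⁻ x, k x := lintegral_sub_left_eq_self k y

theorem lintegral_comp_sub_right (k : Space d → ℝ≥0∞) (x : Space d) :
    ∫⁻ y, k (y - x) = ∫⁻ y, k y := lintegral_sub_right_eq_self k x

/-- A convolution with a kernel of finite integral is bounded on `L^p`. -/
theorem eLpNorm_conv_le (hN : Measurable N) (hk : Measurable k) (hp : 1 ≤ p) :
    eLpNorm (fun x => ∫⁻ y, N y * k (y - x)) p volume ≤ (∫⁻ y, k y) * eLpNorm N p volume := by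
  rcases eq_or_ne p ∞ with rfl | hp'
  · rw [eLpNorm_exponent_top]
    refine eLpNormEssSup_le_of_ae_enorm_bound (ae_of_all _ fun x => ?_)
    rw [enorm_eq_self, ← lintegral_comp_sub_right k x, mul_comm,
      ← lintegral_const_mul _ (by fun_prop : Measurable fun y => k (y - x))]
    refine lintegral_mono_ae ?_
    filter_upwards [ae_le_eLpNorm_top (μ := volume) N] with y hy
    gcongr
  · have h0 : p ≠ 0 := (one_pos.trans_le hp).ne'
    have hpos := ENNReal.toReal_pos h0 hp'
    have h1 : 1 ≤ p.toReal := by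
      rw [← ENNReal.toReal_one]; exact ENNReal.toReal_mono hp' hp
    rw [eLpNorm_eq_lintegral_rpow_enorm_toReal h0 hp', one_div, ENNReal.rpow_inv_le_iff hpos,
      ENNReal.mul_rpow_of_nonneg _ _ hpos.le, eLpNorm_eq_lintegral_rpow_enorm_toReal h0 hp',
      ← ENNReal.rpow_mul, one_div_mul_cancel hpos.ne', ENNReal.rpow_one]
    simp only [enorm_eq_self]
    have hm : Measurable (Function.uncurry fun x y : Space d => N y ^ p.toReal * k (y - x)) :=
      ((hN.comp measurable_snd).pow_const _).mul (hk.comp (measurable_snd.sub measurable_fst))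
    -- Hölder for the density $k(y-x)$ at each $x$, then Tonelli; the powers of $\int k$ add up to
    -- $1+(p-1)=p$.
    calc ∫⁻ x, (∫⁻ y, N y * k (y - x)) ^ p.toReal
        ≤ ∫⁻ x, (∫⁻ y, N y ^ p.toReal * k (y - x)) * (∫⁻ y, k y) ^ (p.toReal - 1) := by
          refine lintegral_mono fun x => ?_
          have := lintegral_mul_rpow_le (μ := volume) hN (hk.comp (measurable_id.sub_const x)) hp hp'
          simpa only [Function.comp_def, id, lintegral_comp_sub_right k x] using this
      _ = (∫⁻ y, N y ^ p.toReal * ∫⁻ x, k x) * (∫⁻ y, k y) ^ (p.toReal - 1) := by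
          rw [lintegral_mul_const _ hm.lintegral_prod_right, lintegral_lintegral_swap hm.aemeasurable]
          congr 2
          funext y
          rw [lintegral_const_mul _ (by fun_prop : Measurable fun x => k (y - x)),
            lintegral_comp_sub_left k y]
      _ = _ := by
          rw [lintegral_mul_const _ (hN.pow_const _), mul_assoc, mul_comm]
          congr 1
          nth_rewrite 1 [← ENNReal.rpow_one (∫⁻ x, k x)]
          rw [← ENNReal.rpow_add_of_nonneg _ _ zero_le_one (by linarith)]
          congr 1
          ring

/-- A convolution with a bounded kernel of finite integral maps `L^p` to bounded functions. -/
theorem exists_conv_le (hk : Measurable k) (hk1 : ∫⁻ y, k y ≠ ∞) {B : ℝ≥0} (hB : ∀ y, k y ≤ B)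
    (hp : 1 ≤ p) : ∃ S : ℝ≥0, ∀ N : Space d → ℝ≥0∞, Measurable N → ∀ x,
      ∫⁻ y, N y * k (y - x) ≤ S * eLpNorm N p volume := by
  rcases eq_or_ne p ∞ with rfl | hp'
  · refine ⟨(∫⁻ y, k y).toNNReal, fun N hN x => ?_⟩
    rw [ENNReal.coe_toNNReal hk1, ← lintegral_comp_sub_right k x, mul_comm,
      ← lintegral_const_mul _ (by fun_prop : Measurable fun y => k (y - x))]
    refine lintegral_mono_ae ?_
    filter_upwards [ae_le_eLpNorm_top (μ := volume) N] with y hy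
    gcongr
  · have h0 : p ≠ 0 := (one_pos.trans_le hp).ne'
    have hpos := ENNReal.toReal_pos h0 hp'
    have h1 : 1 ≤ p.toReal := by
      rw [← ENNReal.toReal_one]; exact ENNReal.toReal_mono hp' hp
    -- This is $B^{1/p}(\int k)^{1-1/p}$: Hölder as before, then $k\le B$ in the remaining integral.
    refine ⟨((B * (∫⁻ y, k y) ^ (p.toReal - 1)) ^ (1 / p.toReal)).toNNReal, fun N hN x => ?_⟩
    have hfin : (B * (∫⁻ y, k y) ^ (p.toReal - 1)) ^ (1 / p.toReal) ≠ ∞ :=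
      ENNReal.rpow_ne_top_of_nonneg (by positivity)
        (ENNReal.mul_ne_top ENNReal.coe_ne_top
          (ENNReal.rpow_ne_top_of_nonneg (by linarith) hk1))
    rw [ENNReal.coe_toNNReal hfin, eLpNorm_eq_lintegral_rpow_enorm_toReal h0 hp',
      ← ENNReal.mul_rpow_of_nonneg _ _ (by positivity), one_div, ENNReal.le_rpow_inv_iff hpos]
    have := lintegral_mul_rpow_le (μ := volume) hN (hk.comp (measurable_id.sub_const x)) hp hp'
    simp only [Function.comp_def, id, lintegral_comp_sub_right k x] at this
    refine this.trans ?_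
    have h2 : ∫⁻ y, N y ^ p.toReal * k (y - x) ≤ B * ∫⁻ y, N y ^ p.toReal := by
      rw [mul_comm, ← lintegral_mul_const _ (hN.pow_const _)]
      exact lintegral_mono fun y => by gcongr; exact hB _
    simp only [enorm_eq_self]
    calc _ ≤ (B * ∫⁻ y, N y ^ p.toReal) * (∫⁻ y, k y) ^ (p.toReal - 1) := by gcongr
      _ = _ := by ring

end Convolution

/-! ### Local Fourier norms of bounded continuous functions. -/

/-- Bounded continuous functions. -/
def IsBC (f : Space d → ℂ) : Prop := Continuous f ∧ ∃ M : ℝ, ∀ x, ‖f x‖ ≤ M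

theorem exists_isGivenBy_of_bounded {f : Space d → ℂ} (hf : AEStronglyMeasurable f) {M : ℝ}
    (hM : ∀ᵐ x, ‖f x‖ ≤ M) : ∃ u : 𝓢'(Space d, ℂ), IsGivenBy u f := by
  have hm : MemLp f ∞ volume := memLp_top_of_bound hf M hM
  refine ⟨Lp.toTemperedDistribution (p := ∞) hm.toLp, fun φ =>
    ⟨integrable_mul_of_bounded hf hM φ, ?_⟩⟩
  rw [Lp.toTemperedDistribution_apply]
  refine integral_congr_ae ?_
  filter_upwards [hm.coeFn_toLp] with x hx
  rw [hx, smul_eq_mul]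

theorem IsGivenBy.congr_ae {u : 𝓢'(Space d, ℂ)} {f f' : Space d → ℂ} (h : IsGivenBy u f)
    (hff : f =ᵐ[volume] f') : IsGivenBy u f' := fun φ => by
  have e : (fun x => φ x * f x) =ᵐ[volume] fun x => φ x * f' x := by
    filter_upwards [hff] with x hx
    rw [hx]
  exact ⟨(h φ).1.congr e, (h φ).2.trans (integral_congr_ae e)⟩

theorem IsGivenBy.ae_eq {u : 𝓢'(Space d, ℂ)} {f f' : Space d → ℂ} (h : IsGivenBy u f)
    (h' : IsGivenBy u f') : f =ᵐ[volume] f' :=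
  ae_eq_of_forall_integral_eq (fun φ => (h φ).1) (fun φ => (h' φ).1)
    fun φ => (h φ).2.symm.trans (h' φ).2

/-- The `L^1` norm in `w` of `𝓕 (f · T_x g) (w)` for a function `f`. -/
noncomputable def stftNorm (g : 𝓢(Space d, ℂ)) (f : Space d → ℂ) (x : Space d) : ℝ≥0∞ :=
  ∫⁻ w, ‖𝓕 (fun t => f t * g (t - x)) w‖ₑ

theorem localNorm_eq_stftNorm (g : 𝓢(Space d, ℂ)) {u : 𝓢'(Space d, ℂ)} {f : Space d → ℂ}
    (h : IsGivenBy u f) : localNorm g u = stftNorm g f := by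
  funext x
  unfold localNorm stftNorm
  congr 1
  funext w
  rw [localFourier, (h _).2, fourier_eq_integral]
  congr 2
  funext t
  rw [timeFreqShift_apply]
  ring

namespace IsBC

variable {f h : Space d → ℂ}

theorem exists_isGivenBy (hf : IsBC f) : ∃ u : 𝓢'(Space d, ℂ), IsGivenBy u f :=
  exists_isGivenBy_of_bounded hf.1.aestronglyMeasurable (ae_of_all _ hf.2.choose_spec)

theorem measurable_stftNorm (hf : IsBC f) (g : 𝓢(Space d, ℂ)) : Measurable (stftNorm g f) := by
  obtain ⟨u, hu⟩ := hf.exists_isGivenBy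
  rw [← localNorm_eq_stftNorm g hu]
  exact measurable_localNorm g u

theorem const (c : ℂ) : IsBC (fun _ : Space d => c) := ⟨continuous_const, ‖c‖, fun _ => le_rfl⟩

theorem mul (hf : IsBC f) (hh : IsBC h) : IsBC fun t => f t * h t := by
  obtain ⟨M, hM⟩ := hf.2
  obtain ⟨M', hM'⟩ := hh.2
  refine ⟨hf.1.mul hh.1, M * M', fun x => ?_⟩
  rw [norm_mul]
  exact mul_le_mul (hM x) (hM' x) (norm_nonneg _) ((norm_nonneg _).trans (hM x))

theorem pow (hf : IsBC f) (n : ℕ) : IsBC fun t => f t ^ n := by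
  obtain ⟨M, hM⟩ := hf.2
  refine ⟨hf.1.pow n, M ^ n, fun x => ?_⟩
  rw [norm_pow]
  exact pow_le_pow_left₀ (norm_nonneg _) (hM x) n

theorem conj (hf : IsBC f) : IsBC fun t => (starRingEnd ℂ) (f t) := by
  obtain ⟨M, hM⟩ := hf.2
  exact ⟨Complex.continuous_conj.comp hf.1, M, fun x => by simpa using hM x⟩

theorem re (hf : IsBC f) : IsBC fun t => ((f t).re : ℂ) := by
  obtain ⟨M, hM⟩ := hf.2
  refine ⟨Complex.continuous_ofReal.comp (Complex.continuous_re.comp hf.1), M, fun x => ?_⟩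
  simpa using (Complex.abs_re_le_norm _).trans (hM x)

theorem im (hf : IsBC f) : IsBC fun t => ((f t).im : ℂ) := by
  obtain ⟨M, hM⟩ := hf.2
  refine ⟨Complex.continuous_ofReal.comp (Complex.continuous_im.comp hf.1), M, fun x => ?_⟩
  simpa using (Complex.abs_im_le_norm _).trans (hM x)

theorem integrable_windowed (hf : IsBC f) (g : 𝓢(Space d, ℂ)) (x : Space d) :
    Integrable fun t => f t * g (t - x) := by
  have h := integrable_mul_of_bounded hf.1.aestronglyMeasurable
    (ae_of_all _ hf.2.choose_spec) (translate g x)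
  exact h.congr (ae_of_all _ fun t => by simp [mul_comm])

theorem continuous_windowed (hf : IsBC f) (g : 𝓢(Space d, ℂ)) (x : Space d) :
    Continuous fun t => f t * g (t - x) :=
  hf.1.mul (by fun_prop)

end IsBC

/-! ### Products, and the convolution of their Fourier transforms. -/

theorem continuous_fourier {a : Space d → ℂ} (ha : Integrable a) : Continuous (𝓕 a) :=
  VectorFourier.fourierIntegral_continuous Real.continuous_fourierChar
    (by exact continuous_inner) ha

/-- The Fourier transform of a product is a convolution. -/
theorem fourier_mul_eq {a b : Space d → ℂ} (ha : Integrable a) (hb : Integrable b)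
    (hbc : Continuous b) (hFb : Integrable (𝓕 b)) (w : Space d) :
    𝓕 (fun t => a t * b t) w = ∫ s, 𝓕 b s * 𝓕 a (w - s) := by
  -- Only $b$ is expanded by Fourier inversion, so $\mathcal F a$ need not be integrable.
  have hinv : ∀ t, b t = ∫ s, fourierExp (-s) t * 𝓕 b s := fun t => by
    rw [← fourierInv_eq_integral, hbc.fourierInv_fourier_eq hb hFb]
  have h1 : ∀ t, fourierExp w t * (a t * b t) =
      ∫ s, 𝓕 b s * (fourierExp (w - s) t * a t) := fun t => by
    rw [hinv t, ← integral_const_mul, ← integral_const_mul]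
    congr 1
    funext s
    rw [sub_eq_add_neg, fourierExp_add]
    ring
  rw [fourier_eq_integral]
  simp_rw [h1]
  rw [integral_integral_swap]
  · refine integral_congr_ae (ae_of_all _ fun s => ?_)
    dsimp only
    rw [integral_const_mul, fourier_eq_integral a]
  · have hi : Integrable (fun z : Space d × Space d => a z.1 * 𝓕 b z.2)
        (volume.prod volume) := ha.mul_prod hFb
    have hc : Continuous fun z : Space d × Space d => fourierExp (w - z.2) z.1 := by
      unfold fourierExp
      fun_prop
    refine (hi.bdd_mul hc.aestronglyMeasurable
      (ae_of_all _ fun z => (norm_fourierExp _ _).le)).congr (ae_of_all _ fun z => ?_)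
    simp only [Function.uncurry]
    ring

theorem lintegral_enorm_fourier_mul_le {a b : Space d → ℂ} (ha : Integrable a)
    (hb : Integrable b) (hbc : Continuous b) (hFb : Integrable (𝓕 b)) :
    ∫⁻ w, ‖𝓕 (fun t => a t * b t) w‖ₑ ≤ (∫⁻ w, ‖𝓕 a w‖ₑ) * ∫⁻ w, ‖𝓕 b w‖ₑ := by
  have hca := continuous_fourier ha
  have hcb := continuous_fourier hb
  have hm : Measurable (Function.uncurry fun w s : Space d => ‖𝓕 b s‖ₑ * ‖𝓕 a (w - s)‖ₑ) := by
    have h1 : Continuous fun z : Space d × Space d => 𝓕 b z.2 := hcb.comp continuous_snd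
    have h2 : Continuous fun z : Space d × Space d => 𝓕 a (z.1 - z.2) :=
      hca.comp (continuous_fst.sub continuous_snd)
    exact h1.enorm.measurable.mul h2.enorm.measurable
  calc ∫⁻ w, ‖𝓕 (fun t => a t * b t) w‖ₑ
      ≤ ∫⁻ w, ∫⁻ s, ‖𝓕 b s‖ₑ * ‖𝓕 a (w - s)‖ₑ := by
        refine lintegral_mono fun w => ?_
        rw [fourier_mul_eq ha hb hbc hFb]
        refine (enorm_integral_le_lintegral_enorm _).trans (le_of_eq ?_)
        simp_rw [enorm_mul]
    _ = ∫⁻ s, ‖𝓕 b s‖ₑ * ∫⁻ w, ‖𝓕 a w‖ₑ := by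
        rw [lintegral_lintegral_swap hm.aemeasurable]
        congr 1
        funext s
        rw [lintegral_const_mul' _ _ enorm_ne_top,
          lintegral_comp_sub_right (fun w => ‖𝓕 a w‖ₑ) s]
    _ = _ := by rw [lintegral_mul_const _ hcb.enorm.measurable, mul_comm]

/-- The window $g^2$ gives one copy of $g$ to each factor. -/
theorem stftNorm_mul_le {f h : Space d → ℂ} (hf : IsBC f) (hh : IsBC h) (g : 𝓢(Space d, ℂ))
    (x : Space d) :
    stftNorm (prod g g) (fun t => f t * h t) x ≤ stftNorm g f x * stftNorm g h x := by
  have hF := continuous_fourier (hf.integrable_windowed g x)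
  have hH := continuous_fourier (hh.integrable_windowed g x)
  have e1 : (fun t => f t * h t * prod g g (t - x)) =
      fun t => (f t * g (t - x)) * (h t * g (t - x)) := by
    funext t; simp; ring
  have e2 : (fun t => f t * h t * prod g g (t - x)) =
      fun t => (h t * g (t - x)) * (f t * g (t - x)) := by
    funext t; simp; ring
  -- The convolution formula needs one factor with integrable transform, and the roles can be
  -- exchanged; if neither has one, the right side is $\infty$.
  rcases eq_or_ne (stftNorm g h x) ∞ with h1 | h1
  · rcases eq_or_ne (stftNorm g f x) ∞ with h2 | h2
    · rw [h1, h2]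
      simp
    · rw [stftNorm, e2, mul_comm]
      exact lintegral_enorm_fourier_mul_le (hh.integrable_windowed g x)
        (hf.integrable_windowed g x) (hf.continuous_windowed g x)
        ⟨hF.aestronglyMeasurable, lt_top_iff_ne_top.2 h2⟩
  · rw [stftNorm, e1]
    exact lintegral_enorm_fourier_mul_le (hf.integrable_windowed g x)
      (hh.integrable_windowed g x) (hh.continuous_windowed g x)
      ⟨hH.aestronglyMeasurable, lt_top_iff_ne_top.2 h1⟩

/-! ### Change of window. -/

theorem exists_seminorm_slice_le {X Y : Type*} [NormedAddCommGroup X] [NormedSpace ℝ X]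
    [NormedAddCommGroup Y] [NormedSpace ℝ Y] (q : Seminorm ℂ 𝓢(X, ℂ)) (hq : Continuous q)
    (H : 𝓢(X × Y, ℂ)) (N : ℕ) :
    ∃ C : ℝ, 0 ≤ C ∧ ∀ y : Y, q (slice H y) ≤ C * (1 + ‖y‖) ^ (-(N : ℝ)) := by
  obtain ⟨s, D, -, hD⟩ := Seminorm.bound_of_continuous (schwartz_withSeminorms ℂ X ℂ) _ hq
  choose C hC0 hC using fun i : ℕ × ℕ => seminorm_slice_le H i.1 i.2 N
  refine ⟨D * ∑ i ∈ s, C i, mul_nonneg D.2 (Finset.sum_nonneg fun i _ => hC0 i), fun y => ?_⟩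
  refine (hD (slice H y)).trans ?_
  rw [mul_assoc]
  refine mul_le_mul_of_nonneg_left ?_ D.2
  refine Seminorm.finset_sup_apply_le
    (mul_nonneg (Finset.sum_nonneg fun i _ => hC0 i) (by positivity)) fun i hi => ?_
  refine (hC i y).trans ?_
  gcongr
  exact Finset.single_le_sum (fun i _ => hC0 i) hi

/-- The map $\varphi\mapsto\|\mathcal F\varphi\|_{L^1}$ is a continuous seminorm on Schwartz space,
so it inherits the decay of slices. -/
theorem exists_lintegral_enorm_fourier_slice_le (H : 𝓢(Space d × Space d, ℂ)) (N : ℕ) :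
    ∃ C : ℝ, 0 ≤ C ∧ ∀ y, ∫⁻ w, ‖𝓕 (fun t => H (t, y)) w‖ₑ ≤
      ENNReal.ofReal (C * (1 + ‖y‖) ^ (-(N : ℝ))) := by
  let L : 𝓢(Space d, ℂ) →L[ℂ] Lp ℂ 1 (volume : Measure (Space d)) :=
    (SchwartzMap.toLpCLM ℂ ℂ 1 volume) ∘L SchwartzMap.fourierTransformCLM ℂ
  obtain ⟨C, hC0, hC⟩ := exists_seminorm_slice_le
    ((normSeminorm ℂ (Lp ℂ 1 (volume : Measure (Space d)))).comp L.toLinearMap)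
    (continuous_norm.comp L.continuous) H N
  refine ⟨C, hC0, fun y => ?_⟩
  have h1 : ‖(𝓕 (slice H y)).toLp 1 volume‖ ≤ C * (1 + ‖y‖) ^ (-(N : ℝ)) := hC y
  rw [SchwartzMap.norm_toLp, eLpNorm_one_eq_lintegral_enorm] at h1
  have h2 : ∫⁻ w, ‖(𝓕 (slice H y)) w‖ₑ < ∞ := (𝓕 (slice H y)).integrable.2
  rw [← ENNReal.le_ofReal_iff_toReal_le h2.ne (by positivity)] at h1
  exact h1

theorem lintegral_enorm_fourier_comp_sub (b : Space d → ℂ) (x : Space d) :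
    ∫⁻ w, ‖𝓕 (fun t => b (t - x)) w‖ₑ = ∫⁻ w, ‖𝓕 b w‖ₑ := by
  congr 1
  funext w
  have h : 𝓕 (fun t => b (t - x)) w = fourierExp w x * 𝓕 b w := by
    rw [fourier_eq_integral, fourier_eq_integral, ← integral_const_mul,
      ← integral_sub_right_eq_self (fun t => fourierExp w x * (fourierExp w t * b t)) x]
    congr 1
    funext t
    rw [← mul_assoc, fourierExp_comm w x, fourierExp_comm w (t - x), ← fourierExp_add,
      add_sub_cancel, fourierExp_comm]
  rw [h, enorm_mul, ← ofReal_norm, norm_fourierExp, ENNReal.ofReal_one, one_mul]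

/-- Translation does not change the $L^1$ norm of the transform, so only the slice of
$\eta(t)\gamma(t-(y-x))$ at $y-x$ matters. -/
theorem exists_lintegral_enorm_fourier_windows_le (η γ : 𝓢(Space d, ℂ)) (N : ℕ) :
    ∃ C : ℝ, 0 ≤ C ∧ ∀ x y, ∫⁻ w, ‖𝓕 (fun t => η (t - x) * γ (t - y)) w‖ₑ ≤
      ENNReal.ofReal (C * (1 + ‖y - x‖) ^ (-(N : ℝ))) := by
  obtain ⟨C, hC0, hC⟩ := exists_lintegral_enorm_fourier_slice_le (shear η γ) N
  refine ⟨C, hC0, fun x y => ?_⟩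
  have h := lintegral_enorm_fourier_comp_sub (fun t => shear η γ (t, y - x)) x
  simp only [shear_apply, sub_sub_sub_cancel_right] at h
  rw [h]
  simpa only [shear_apply] using hC (y - x)

section WindowChange

/-- Insert $1=\int g_0(t-y)\gamma(t-y)\,dy$, pair $g_0$ with $f$ and $\gamma$ with the new window,
and apply the $L^1$ bound for products for each $y$. -/
theorem stftNorm_le_lintegral {g₀ γ : 𝓢(Space d, ℂ)} (hγ : ∫ t, g₀ t * γ t = 1)
    (η : 𝓢(Space d, ℂ)) {f : Space d → ℂ} (hf : IsBC f) (x : Space d) :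
    stftNorm η f x ≤
      ∫⁻ y, stftNorm g₀ f y * ∫⁻ w, ‖𝓕 (fun t => η (t - x) * γ (t - y)) w‖ₑ := by
  obtain ⟨M, hM⟩ := hf.2
  let φ : Space d → Space d → ℂ := fun y t => (f t * g₀ (t - y)) * (η (t - x) * γ (t - y))
  have hφ : ∀ y t, φ y t = f t * shear (translate η x) (prod g₀ γ) (t, y) := fun y t => by
    simp [φ]; ring
  have hrep : ∀ w, 𝓕 (fun t => f t * η (t - x)) w = ∫ y, 𝓕 (φ y) w := fun w => by
    rw [fourier_eq_integral]
    simp_rw [fourier_eq_integral, hφ]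
    rw [integral_integral_swap]
    · refine integral_congr_ae (ae_of_all _ fun t => ?_)
      simp only [shear_apply, prod_apply, translate_apply]
      rw [integral_const_mul, integral_const_mul, integral_const_mul,
        integral_sub_left_eq_self (fun s => g₀ s * γ s) volume t, hγ, mul_one]
    · have : ((volume : Measure (Space d)).prod (volume : Measure (Space d))).HasTemperateGrowth :=
        Measure.IsAddHaarMeasure.instHasTemperateGrowth
      have hi : Integrable (shear (translate η x) (prod g₀ γ))
        ((volume : Measure (Space d)).prod volume) := SchwartzMap.integrable _
      have hc : Continuous fun z : Space d × Space d => fourierExp w z.1 * f z.1 := by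
        have := hf.1
        unfold fourierExp
        fun_prop
      have hb := hi.bdd_mul (c := M) hc.aestronglyMeasurable (ae_of_all _ fun z => by
        rw [norm_mul, norm_fourierExp, one_mul]
        exact hM z.1)
      refine hb.swap.congr (ae_of_all _ fun z => ?_)
      simp only [Function.comp_apply, Function.uncurry, Prod.swap]
      ring
  have hm : Measurable (Function.uncurry fun w y : Space d => ‖𝓕 (φ y) w‖ₑ) := by
    have hc : Continuous fun z : (Space d × Space d) × Space d =>
        fourierExp z.1.1 z.2 * φ z.1.2 z.2 := by
      have := hf.1
      unfold fourierExp
      fun_prop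
    have h1 := hc.stronglyMeasurable.integral_prod_right' (ν := (volume : Measure (Space d)))
    simp only [← fourier_eq_integral] at h1
    exact h1.enorm
  calc stftNorm η f x ≤ ∫⁻ w, ∫⁻ y, ‖𝓕 (φ y) w‖ₑ := by
        refine lintegral_mono fun w => ?_
        rw [hrep]
        exact enorm_integral_le_lintegral_enorm _
    _ = ∫⁻ y, ∫⁻ w, ‖𝓕 (φ y) w‖ₑ := lintegral_lintegral_swap hm.aemeasurable
    _ ≤ _ := by
        refine lintegral_mono fun y => ?_
        have e : (fun t => η (t - x) * γ (t - y)) = prod (translate η x) (translate γ y) := by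
          funext t; simp
        have hF : Integrable (𝓕 (fun t => η (t - x) * γ (t - y))) := by
          rw [e, ← SchwartzMap.fourier_coe]
          exact SchwartzMap.integrable _
        exact lintegral_enorm_fourier_mul_le (hf.integrable_windowed g₀ y)
          (by rw [e]; exact SchwartzMap.integrable _) (by fun_prop) hF

/-- Changing the window is controlled by a convolution with a bounded integrable kernel. -/
theorem exists_window_kernel {g₀ : 𝓢(Space d, ℂ)} (hg₀ : g₀ ≠ 0) (η : 𝓢(Space d, ℂ)) :
    ∃ k : Space d → ℝ≥0∞, Measurable k ∧ ∫⁻ y, k y ≠ ∞ ∧ (∃ B : ℝ≥0, ∀ y, k y ≤ B) ∧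
      ∀ f, IsBC f → ∀ x, stftNorm η f x ≤ ∫⁻ y, stftNorm g₀ f y * k (y - x) := by
  obtain ⟨γ, hγ⟩ := exists_integral_mul_eq_one hg₀
  set n := (volume : Measure (Space d)).integrablePower
  obtain ⟨C, hC0, hC⟩ := exists_lintegral_enorm_fourier_windows_le η γ n
  have hi : Integrable fun y : Space d => C * (1 + ‖y‖) ^ (-(n : ℝ)) :=
    ((volume : Measure (Space d)).integrable_pow_neg_integrablePower).const_mul C
  refine ⟨fun y => ENNReal.ofReal (C * (1 + ‖y‖) ^ (-(n : ℝ))), by fun_prop, ?_,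
    ⟨C.toNNReal, fun y => ?_⟩, fun f hf x => ?_⟩
  · exact hi.lintegral_lt_top.ne
  · refine ENNReal.ofReal_le_ofReal (mul_le_of_le_one_right hC0 ?_)
    exact Real.rpow_le_one_of_one_le_of_nonpos (by simp) (by simp)
  · refine (stftNorm_le_lintegral hγ η hf x).trans (lintegral_mono fun y => ?_)
    gcongr
    exact hC x y

end WindowChange

/-! ### The algebra property, and real and imaginary parts. -/

/-- The norm of `W^{p,1}` for functions. -/
noncomputable def functionNorm (g : 𝓢(Space d, ℂ)) (p : ℝ≥0∞) (f : Space d → ℂ) : ℝ≥0∞ :=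
  eLpNorm (stftNorm g f) p volume

theorem amalgamNorm_eq_functionNorm (g : 𝓢(Space d, ℂ)) (p : ℝ≥0∞) {u : 𝓢'(Space d, ℂ)}
    {f : Space d → ℂ} (h : IsGivenBy u f) : amalgamNorm g p 1 u = functionNorm g p f := by
  rw [amalgamNorm_one_eq, localNorm_eq_stftNorm g h, functionNorm]

variable {p : ℝ≥0∞} {g : 𝓢(Space d, ℂ)}

theorem exists_functionNorm_window_le (hg : g ≠ 0) (hp : 1 ≤ p) (η : 𝓢(Space d, ℂ)) :
    ∃ K : ℝ≥0, ∀ f, IsBC f → functionNorm η p f ≤ K * functionNorm g p f := by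
  obtain ⟨k, hk, hk1, -, h⟩ := exists_window_kernel hg η
  refine ⟨(∫⁻ y, k y).toNNReal, fun f hf => ?_⟩
  rw [ENNReal.coe_toNNReal hk1]
  exact (eLpNorm_mono_enorm (h f hf)).trans (eLpNorm_conv_le (hf.measurable_stftNorm g) hk hp)

/-- `W^{p,1}` is an algebra under pointwise multiplication. -/
theorem exists_functionNorm_mul_le (hg : g ≠ 0) (hp : 1 ≤ p) :
    ∃ A : ℝ≥0, ∀ f h, IsBC f → IsBC h → functionNorm g p h ≠ ∞ →
      functionNorm g p (fun t => f t * h t) ≤ A * (functionNorm g p f * functionNorm g p h) := by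
  have hgg : prod g g ≠ 0 := fun h0 => hg <| SchwartzMap.ext fun t => by
    simpa using DFunLike.congr_fun h0 t
  -- `k₁` passes from $g^2$ to $g$. `k₂` compares $g$ with itself: its boundedness turns the $L^p$
  -- norm of $h$ into a bound for every $y$.
  obtain ⟨k₁, hk₁, hi₁, -, h₁⟩ := exists_window_kernel hgg g
  obtain ⟨k₂, hk₂, hi₂, ⟨B, hB⟩, h₂⟩ := exists_window_kernel hg g
  obtain ⟨S, hS⟩ := exists_conv_le hk₂ hi₂ hB hp
  refine ⟨S * (∫⁻ y, k₁ y).toNNReal, fun f h hf hh hfin => ?_⟩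
  have hsup : ∀ y, stftNorm g h y ≤ S * functionNorm g p h := fun y =>
    (h₂ h hh y).trans (hS _ (hh.measurable_stftNorm g) y)
  have hT : ((S * (functionNorm g p h).toNNReal : ℝ≥0) : ℝ≥0∞) = S * functionNorm g p h := by
    rw [ENNReal.coe_mul, ENNReal.coe_toNNReal hfin]
  have hle : ∀ x, stftNorm g (fun t => f t * h t) x ≤
      (S * (functionNorm g p h).toNNReal : ℝ≥0) * ∫⁻ y, stftNorm g f y * k₁ (y - x) := fun x => by
    rw [hT, ← lintegral_const_mul' _ _ (ENNReal.mul_ne_top ENNReal.coe_ne_top hfin)]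
    refine (h₁ _ (hf.mul hh) x).trans (lintegral_mono fun y => ?_)
    calc _ ≤ stftNorm g f y * (S * functionNorm g p h) * k₁ (y - x) := by
          gcongr
          exact (stftNorm_mul_le hf hh g y).trans (by gcongr; exact hsup y)
      _ = _ := by ring
  calc functionNorm g p (fun t => f t * h t)
      ≤ (S * (functionNorm g p h).toNNReal : ℝ≥0) *
          ((∫⁻ y, k₁ y) * functionNorm g p f) :=
        (eLpNorm_mono_enorm hle).trans ((eLpNorm_ennreal_const_mul_le _ _).trans (by
          gcongr
          exact eLpNorm_conv_le (hf.measurable_stftNorm g) hk₁ hp))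
    _ = _ := by
        rw [hT, ENNReal.coe_mul, ENNReal.coe_toNNReal hi₁]
        ring

/-- $\mathcal F(\bar f\,T_xg)(w)$ is the conjugate of $\mathcal F(f\,T_x\bar g)(-w)$. -/
theorem stftNorm_conj (g : 𝓢(Space d, ℂ)) (f : Space d → ℂ) :
    stftNorm g (fun t => (starRingEnd ℂ) (f t)) = stftNorm (conjugate g) f := by
  funext x
  unfold stftNorm
  rw [← lintegral_neg_eq_self]
  congr 1
  funext w
  have he : ∀ z : ℂ, ‖(starRingEnd ℂ) z‖ₑ = ‖z‖ₑ := fun z => by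
    rw [← ofReal_norm, RCLike.norm_conj, ofReal_norm]
  rw [fourier_eq_integral, fourier_eq_integral, ← he, ← integral_conj]
  congr 2
  funext t
  simp [fourierExp_neg]

theorem stftNorm_add_le {f h : Space d → ℂ} (hf : IsBC f) (hh : IsBC h) (x : Space d) :
    stftNorm g (fun t => f t + h t) x ≤ stftNorm g f x + stftNorm g h x := by
  unfold stftNorm
  rw [← lintegral_add_left (continuous_fourier (hf.integrable_windowed g x)).enorm.measurable]
  refine lintegral_mono fun w => ?_
  refine le_trans (le_of_eq ?_) (enorm_add_le _ _)
  have hi : ∀ f, IsBC f → Integrable fun t => fourierExp w t * (f t * g (t - x)) := fun f hf =>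
    (hf.integrable_windowed g x).bdd_mul (c := 1)
      (continuous_fourierExp.comp (Continuous.prodMk_right w)).aestronglyMeasurable
      (ae_of_all _ fun t => (norm_fourierExp w t).le)
  rw [fourier_eq_integral, fourier_eq_integral, fourier_eq_integral,
    ← integral_add (hi f hf) (hi h hh)]
  congr 2
  funext t
  ring

theorem stftNorm_const_mul (c : ℂ) (f : Space d → ℂ) (x : Space d) :
    stftNorm g (fun t => c * f t) x = ‖c‖ₑ * stftNorm g f x := by
  unfold stftNorm
  rw [← lintegral_const_mul' _ _ enorm_ne_top]
  congr 1
  funext w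
  rw [fourier_eq_integral, fourier_eq_integral, ← enorm_mul, ← integral_const_mul]
  congr 2
  funext t
  ring

theorem functionNorm_const_mul_le (c : ℂ) (f : Space d → ℂ) :
    functionNorm g p (fun t => c * f t) ≤ ‖c‖ₑ * functionNorm g p f := by
  have : stftNorm g (fun t => c * f t) = fun x => (‖c‖₊ : ℝ≥0∞) * stftNorm g f x :=
    funext fun x => stftNorm_const_mul c f x
  rw [functionNorm, this]
  exact eLpNorm_ennreal_const_mul_le _ _

theorem functionNorm_add_le {f h : Space d → ℂ} (hf : IsBC f) (hh : IsBC h) (hp : 1 ≤ p) :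
    functionNorm g p (fun t => f t + h t) ≤ functionNorm g p f + functionNorm g p h :=
  (eLpNorm_mono_enorm (g := stftNorm g f + stftNorm g h) (stftNorm_add_le hf hh)).trans
    (eLpNorm_add_le (hf.measurable_stftNorm g).aestronglyMeasurable
      (hh.measurable_stftNorm g).aestronglyMeasurable hp)

theorem functionNorm_conj (f : Space d → ℂ) :
    functionNorm g p (fun t => (starRingEnd ℂ) (f t)) = functionNorm (conjugate g) p f := by
  rw [functionNorm, stftNorm_conj, functionNorm]

/-- Common form of $\mathrm{Re} f$ and $\mathrm{Im} f$; the coefficients of modulus $1/2$ average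
two norms, each at most $K\|f\|$ since $K\ge1$. -/
theorem functionNorm_combination_le {f : Space d → ℂ} (hf : IsBC f) (hp : 1 ≤ p) {K : ℝ≥0∞}
    (hK : 1 ≤ K) (h : functionNorm (conjugate g) p f ≤ K * functionNorm g p f) {c c' : ℂ}
    (hc : ‖c‖ = 1 / 2) (hc' : ‖c'‖ = 1 / 2) :
    functionNorm g p (fun t => c * f t + c' * (starRingEnd ℂ) (f t)) ≤
      K * functionNorm g p f := by
  have e : ∀ c : ℂ, ‖c‖ = 1 / 2 → ‖c‖ₑ = 2⁻¹ := fun c hc => by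
    rw [← ofReal_norm, hc, one_div, ENNReal.ofReal_inv_of_pos two_pos]
    simp
  refine (functionNorm_add_le ((IsBC.const c).mul hf) ((IsBC.const c').mul hf.conj) hp).trans ?_
  refine (add_le_add (functionNorm_const_mul_le _ _) (functionNorm_const_mul_le _ _)).trans ?_
  rw [e c hc, e c' hc', functionNorm_conj, ← mul_add]
  calc (2 : ℝ≥0∞)⁻¹ * (functionNorm g p f + functionNorm (conjugate g) p f)
      ≤ 2⁻¹ * (K * functionNorm g p f + K * functionNorm g p f) := by
        gcongr
        exact le_mul_of_one_le_left' hK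
    _ = _ := by
        rw [← two_mul, ← mul_assoc, ENNReal.inv_mul_cancel two_ne_zero ENNReal.ofNat_ne_top, one_mul]

theorem functionNorm_re_le {f : Space d → ℂ} (hf : IsBC f) (hp : 1 ≤ p) {K : ℝ≥0∞}
    (hK : 1 ≤ K) (h : functionNorm (conjugate g) p f ≤ K * functionNorm g p f) :
    functionNorm g p (fun t => ((f t).re : ℂ)) ≤ K * functionNorm g p f := by
  have e : (fun t => ((f t).re : ℂ)) =
      fun t => (1 / 2 : ℂ) * f t + (1 / 2 : ℂ) * (starRingEnd ℂ) (f t) := by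
    funext t
    rw [Complex.re_eq_add_conj]
    ring
  rw [e]
  exact functionNorm_combination_le hf hp hK h (by simp) (by simp)

theorem functionNorm_im_le {f : Space d → ℂ} (hf : IsBC f) (hp : 1 ≤ p) {K : ℝ≥0∞}
    (hK : 1 ≤ K) (h : functionNorm (conjugate g) p f ≤ K * functionNorm g p f) :
    functionNorm g p (fun t => ((f t).im : ℂ)) ≤ K * functionNorm g p f := by
  have e : (fun t => ((f t).im : ℂ)) =
      fun t => (-Complex.I / 2 : ℂ) * f t + (Complex.I / 2 : ℂ) * (starRingEnd ℂ) (f t) := by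
    funext t
    rw [Complex.im_eq_sub_conj]
    field_simp
    rw [Complex.I_sq]
    ring
  rw [e]
  exact functionNorm_combination_le hf hp hK h (by simp) (by simp)

/-- The norm multiplied by $A$ is submultiplicative, so one factor is split off at a time. The
induction starts in degree 1, since the constant 1 can have infinite norm. -/
theorem functionNorm_monomial_le {A R : ℝ≥0∞}
    (hA : ∀ f h, IsBC f → IsBC h → functionNorm g p h ≠ ∞ →
      functionNorm g p (fun t => f t * h t) ≤ A * (functionNorm g p f * functionNorm g p h))
    (hR : R ≠ ∞) {s t : Space d → ℂ} (hs : IsBC s) (ht : IsBC t)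
    (hsR : functionNorm g p s ≤ R) (htR : functionNorm g p t ≤ R) (k : ℕ) :
    ∀ m n, m + n = k + 1 →
      A * functionNorm g p (fun y => s y ^ m * t y ^ n) ≤ (A * R) ^ (k + 1) := by
  have step : ∀ (φ h : Space d → ℂ) (j : ℕ), IsBC φ → IsBC h → functionNorm g p h ≤ R →
      A * functionNorm g p φ ≤ (A * R) ^ (j + 1) →
      A * functionNorm g p (fun y => φ y * h y) ≤ (A * R) ^ (j + 1 + 1) := fun φ h j hφ hh hhR hj =>
    calc A * functionNorm g p (fun y => φ y * h y)
        ≤ A * (A * (functionNorm g p φ * functionNorm g p h)) := by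
          gcongr
          exact hA φ h hφ hh (ne_top_of_le_ne_top hR hhR)
      _ = (A * functionNorm g p φ) * (A * functionNorm g p h) := by ring
      _ ≤ (A * R) ^ (j + 1) * (A * R) := by gcongr
      _ = _ := (pow_succ _ _).symm
  induction k with
  | zero =>
    intro m n hmn
    obtain ⟨rfl, rfl⟩ | ⟨rfl, rfl⟩ : (m = 1 ∧ n = 0) ∨ (m = 0 ∧ n = 1) := by omega
    · simpa using mul_le_mul_right hsR A
    · simpa using mul_le_mul_right htR A
  | succ k ih =>
    intro m n hmn
    rcases m with _ | m
    · obtain ⟨n, rfl⟩ : ∃ j, n = j + 1 := ⟨n - 1, by omega⟩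
      have := step _ t k ((hs.pow 0).mul (ht.pow n)) ht htR (ih 0 n (by omega))
      convert this using 3
      funext y
      ring
    · have := step _ s k ((hs.pow m).mul (ht.pow n)) hs hsR (ih m n (by omega))
      convert this using 3
      funext y
      ring

/-! ### Real entire functions and composition. -/

variable {F : ℂ → ℂ} {a : ℕ → ℕ → ℂ}

namespace IsRealEntireWith

theorem coeff_zero (h : IsRealEntireWith F a) (hF : F 0 = 0) : a 0 0 = 0 := by
  have h1 := (h 0 0).2
  have h2 := hasSum_single (f := fun k : ℕ × ℕ =>
    a k.1 k.2 * ((0 : ℝ) : ℂ) ^ k.1 * ((0 : ℝ) : ℂ) ^ k.2) (0, 0) fun k hk => by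
      rcases k with ⟨m, n⟩
      rcases Nat.eq_zero_or_pos m with rfl | hm
      · rcases Nat.eq_zero_or_pos n with rfl | hn
        · exact absurd rfl hk
        · simp [hn.ne']
      · simp [hm.ne']
  have := h2.unique h1
  simpa [hF] using this

/-- Absolute convergence at the diagonal point $s=t=r$ controls all total degrees at once. -/
theorem summable_norm_mul_pow (h : IsRealEntireWith F a) (r : ℝ) :
    Summable fun k : ℕ × ℕ => ‖a k.1 k.2‖ * |r| ^ (k.1 + k.2) := by
  refine (h r r).1.congr fun k => ?_
  simp [pow_add, mul_assoc]

theorem majorant_lt_top (h : IsRealEntireWith F a) {r : ℝ≥0∞} (hr : r ≠ ∞) :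
    majorant a r < ∞ := by
  lift r to ℝ≥0 using hr
  have hs : Summable fun k : ℕ × ℕ => ‖a k.1 k.2‖₊ * r ^ (k.1 + k.2) := by
    rw [← NNReal.summable_coe]
    refine (h.summable_norm_mul_pow r).congr fun k => ?_
    simp
  rw [lt_top_iff_ne_top]
  refine ne_of_eq_of_ne (tsum_congr fun k => ?_) (ENNReal.tsum_coe_ne_top_iff_summable.2 hs)
  rw [ENNReal.coe_mul, ENNReal.coe_pow, enorm_eq_nnnorm]

theorem eq_tsum (h : IsRealEntireWith F a) (z : ℂ) :
    F z = ∑' k : ℕ × ℕ, a k.1 k.2 * ((z.re : ℂ) ^ k.1 * (z.im : ℂ) ^ k.2) := by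
  have := (h z.re z.im).2.tsum_eq
  rw [Complex.re_add_im] at this
  rw [← this]
  exact tsum_congr fun k => mul_assoc _ _ _

theorem norm_term_le (z : ℂ) {M : ℝ} (hM : ‖z‖ ≤ M) (k : ℕ × ℕ) :
    ‖a k.1 k.2 * ((z.re : ℂ) ^ k.1 * (z.im : ℂ) ^ k.2)‖ ≤ ‖a k.1 k.2‖ * |M| ^ (k.1 + k.2) := by
  have h1 : |z.re| ≤ |M| := (Complex.abs_re_le_norm z).trans (hM.trans (le_abs_self M))
  have h2 : |z.im| ≤ |M| := (Complex.abs_im_le_norm z).trans (hM.trans (le_abs_self M))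
  rw [norm_mul, norm_mul, norm_pow, norm_pow, Complex.norm_real, Complex.norm_real,
    Real.norm_eq_abs, Real.norm_eq_abs, pow_add]
  gcongr

theorem isBC_comp (h : IsRealEntireWith F a) {f : Space d → ℂ} (hf : IsBC f) :
    IsBC fun x => F (f x) := by
  obtain ⟨M, hM⟩ := hf.2
  have hs := h.summable_norm_mul_pow M
  have hb : ∀ (k : ℕ × ℕ) x, _ := fun k x => norm_term_le (a := a) (f x) (hM x) k
  simp_rw [h.eq_tsum]
  refine ⟨continuous_tsum (fun k => ?_) hs hb, _, fun x => tsum_of_norm_bounded hs.hasSum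
    fun k => hb k x⟩
  exact continuous_const.mul ((hf.re.pow k.1).mul (hf.im.pow k.2)).1

/-- As $f$ is bounded, the series converges absolutely in $L^1$ after multiplication by the window,
so it commutes with $\mathcal F$. -/
theorem stftNorm_comp_le (h : IsRealEntireWith F a) {f : Space d → ℂ} (hf : IsBC f)
    (g : 𝓢(Space d, ℂ)) (x : Space d) :
    stftNorm g (fun t => F (f t)) x ≤ ∑' k : ℕ × ℕ, ‖a k.1 k.2‖ₑ *
      stftNorm g (fun t => ((f t).re : ℂ) ^ k.1 * ((f t).im : ℂ) ^ k.2) x := by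
  obtain ⟨M, hM⟩ := hf.2
  have hmono : ∀ k : ℕ × ℕ,
      IsBC fun t => a k.1 k.2 * (((f t).re : ℂ) ^ k.1 * ((f t).im : ℂ) ^ k.2) := fun k =>
    (IsBC.const _).mul ((hf.re.pow k.1).mul (hf.im.pow k.2))
  let φ : ℕ × ℕ → Space d → ℂ := fun k t =>
    a k.1 k.2 * (((f t).re : ℂ) ^ k.1 * ((f t).im : ℂ) ^ k.2) * g (t - x)
  have hφ : ∀ k, Integrable (φ k) := fun k => (hmono k).integrable_windowed g x
  have hrep : ∀ w, 𝓕 (fun t => F (f t) * g (t - x)) w = ∑' k, 𝓕 (φ k) w := fun w => by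
    have hi : ∀ k, Integrable fun t => fourierExp w t * φ k t := fun k =>
      (hφ k).bdd_mul (c := 1)
        (continuous_fourierExp.comp (Continuous.prodMk_right w)).aestronglyMeasurable
        (ae_of_all _ fun t => (norm_fourierExp w t).le)
    have hgi : Integrable fun t => ‖g (t - x)‖ := by
      simpa using (translate g x).integrable.norm
    have hsum : Summable fun k => ∫ t, ‖fourierExp w t * φ k t‖ := by
      refine Summable.of_nonneg_of_le (fun k => by positivity) (fun k => ?_)
        ((h.summable_norm_mul_pow M).mul_right (∫ t, ‖g (t - x)‖))
      rw [← integral_const_mul]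
      refine integral_mono (hi k).norm (hgi.const_mul _) fun t => ?_
      simp only [φ]
      rw [norm_mul, norm_fourierExp, one_mul, norm_mul]
      gcongr
      exact norm_term_le (f t) (hM t) k
    have key := hasSum_integral_of_summable_integral_norm hi hsum
    simp_rw [fourier_eq_integral]
    rw [key.tsum_eq]
    congr 1
    funext t
    rw [tsum_mul_left, tsum_mul_right, h.eq_tsum]
  calc stftNorm g (fun t => F (f t)) x ≤ ∫⁻ w, ∑' k, ‖𝓕 (φ k) w‖ₑ := by
        refine lintegral_mono fun w => ?_
        rw [hrep]
        exact enorm_tsum_le_tsum_enorm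
    _ = ∑' k, ∫⁻ w, ‖𝓕 (φ k) w‖ₑ :=
        lintegral_tsum fun k => (continuous_fourier (hφ k)).enorm.measurable.aemeasurable
    _ = _ := tsum_congr fun k => stftNorm_const_mul _ _ x

theorem functionNorm_comp_le (h : IsRealEntireWith F a) {f : Space d → ℂ} (hf : IsBC f)
    (g : 𝓢(Space d, ℂ)) {p : ℝ≥0∞} (hp : 1 ≤ p) :
    functionNorm g p (fun t => F (f t)) ≤ ∑' k : ℕ × ℕ, ‖a k.1 k.2‖ₑ *
      functionNorm g p (fun t => ((f t).re : ℂ) ^ k.1 * ((f t).im : ℂ) ^ k.2) := by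
  let N : ℕ × ℕ → Space d → ℝ≥0∞ := fun k =>
    stftNorm g (fun t => ((f t).re : ℂ) ^ k.1 * ((f t).im : ℂ) ^ k.2)
  have hN : ∀ k, Measurable (N k) := fun k =>
    ((hf.re.pow k.1).mul (hf.im.pow k.2)).measurable_stftNorm g
  have h1 : functionNorm g p (fun t => F (f t)) ≤
      eLpNorm (fun x => ∑' k : ℕ × ℕ, (‖a k.1 k.2‖₊ : ℝ≥0∞) * N k x) p volume :=
    eLpNorm_mono_enorm (h.stftNorm_comp_le hf g)
  have h2 := eLpNorm_tsum_le (μ := volume) (p := p)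
    (N := fun (k : ℕ × ℕ) x => (‖a k.1 k.2‖₊ : ℝ≥0∞) * N k x) (fun k => (hN k).const_mul _) hp
  exact (h1.trans h2).trans (ENNReal.tsum_le_tsum fun k => eLpNorm_ennreal_const_mul_le _ (N k))

theorem mul_functionNorm_comp_le (h : IsRealEntireWith F a) (hF : F 0 = 0) {f : Space d → ℂ}
    (hf : IsBC f) (g : 𝓢(Space d, ℂ)) {p : ℝ≥0∞} (hp : 1 ≤ p) {A R : ℝ≥0∞} (hR : R ≠ ∞)
    (hA : ∀ f h, IsBC f → IsBC h → functionNorm g p h ≠ ∞ →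
      functionNorm g p (fun t => f t * h t) ≤ A * (functionNorm g p f * functionNorm g p h))
    (hre : functionNorm g p (fun t => ((f t).re : ℂ)) ≤ R)
    (him : functionNorm g p (fun t => ((f t).im : ℂ)) ≤ R) :
    A * functionNorm g p (fun t => F (f t)) ≤ majorant a (A * R) := by
  refine (mul_le_mul_right (h.functionNorm_comp_le hf g hp) A).trans ?_
  rw [← ENNReal.tsum_mul_left]
  refine ENNReal.tsum_le_tsum fun ⟨m, n⟩ => ?_
  -- The term of degree 0, where the monomial bound is not available, is killed by $a_{00}=0$.
  rcases Nat.eq_zero_or_pos (m + n) with h0 | h0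
  · obtain ⟨rfl, rfl⟩ : m = 0 ∧ n = 0 := by omega
    simp [h.coeff_zero hF]
  · obtain ⟨k, hk⟩ : ∃ k, m + n = k + 1 := ⟨m + n - 1, by omega⟩
    rw [mul_left_comm, hk]
    gcongr
    exact functionNorm_monomial_le hA hR hf.re hf.im hre him k m n hk

end IsRealEntireWith

theorem conjugate_eq_self {g : 𝓢(Space d, ℂ)} (hg : ∀ t, (g t).im = 0) : conjugate g = g := by
  ext t
  simpa using Complex.conj_eq_iff_im.2 (hg t)

end WienerAmalgam

theorem mainTheorem4 (d : ℕ) (p : ℝ≥0∞) (hp : 1 ≤ p)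
    (g : 𝓢(EuclideanSpace ℝ (Fin d), ℂ)) (hg : g ≠ 0) :
    (∀ u ∈ WienerAmalgam.amalgamSpace g p 1,
      ∃ f : EuclideanSpace ℝ (Fin d) → ℂ, Continuous f ∧ (∃ M : ℝ, ∀ x, ‖f x‖ ≤ M) ∧
        WienerAmalgam.IsGivenBy u f) ∧
    ∃ C : ℝ≥0, 0 < C ∧
      ∀ (F : ℂ → ℂ) (a : ℕ → ℕ → ℂ), WienerAmalgam.IsRealEntireWith F a → F 0 = 0 →
      ∀ u ∈ WienerAmalgam.amalgamSpace g p 1,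
      ∀ f : EuclideanSpace ℝ (Fin d) → ℂ, WienerAmalgam.IsGivenBy u f →
        ∃ v ∈ WienerAmalgam.amalgamSpace g p 1,
          WienerAmalgam.IsGivenBy v (fun x => F (f x)) ∧
          WienerAmalgam.majorant a (C * WienerAmalgam.amalgamNorm g p 1 u) < ∞ ∧
          WienerAmalgam.amalgamNorm g p 1 v ≤
            C * WienerAmalgam.majorant a (C * WienerAmalgam.amalgamNorm g p 1 u) ∧
          ((∀ t, (g t).im = 0) →
            C * WienerAmalgam.amalgamNorm g p 1 v ≤
              WienerAmalgam.majorant a (C * WienerAmalgam.amalgamNorm g p 1 u)) := by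
  have hp0 : p ≠ 0 := (one_pos.trans_le hp).ne'
  refine ⟨fun u hu => WienerAmalgam.exists_isGivenBy hg hp0 hu, ?_⟩
  obtain ⟨A₀, hA₀⟩ := WienerAmalgam.exists_functionNorm_mul_le hg hp
  obtain ⟨K₀, hK₀⟩ := WienerAmalgam.exists_functionNorm_window_le hg hp (WienerAmalgam.conjugate g)
  obtain ⟨A, hA1, hAA⟩ : ∃ A : ℝ≥0, 1 ≤ A ∧ A₀ ≤ A := ⟨max A₀ 1, le_max_right _ _, le_max_left _ _⟩
  obtain ⟨K, hK1, hKK⟩ : ∃ K : ℝ≥0, 1 ≤ K ∧ K₀ ≤ K := ⟨max K₀ 1, le_max_right _ _, le_max_left _ _⟩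
  -- Any larger algebra constant also works: the general bound uses $A$, the bound for real windows
  -- uses $AK$.
  have hmul : ∀ B : ℝ≥0, A₀ ≤ B → ∀ f h, WienerAmalgam.IsBC f → WienerAmalgam.IsBC h →
      WienerAmalgam.functionNorm g p h ≠ ∞ → WienerAmalgam.functionNorm g p (fun t => f t * h t) ≤
        B * (WienerAmalgam.functionNorm g p f * WienerAmalgam.functionNorm g p h) :=
    fun B hB f h hf hh hfin => (hA₀ f h hf hh hfin).trans (by gcongr)
  have hAC : A ≤ A * K := le_mul_of_one_le_right' hK1
  have h1C : 1 ≤ A * K := hA1.trans hAC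
  refine ⟨A * K, one_pos.trans_le h1C, fun F a hF hF0 u hu f hf => ?_⟩
  -- The given $f$ is determined only almost everywhere, so the argument runs on the bounded
  -- continuous representative $f_0$.
  obtain ⟨f₀, hf₀c, hf₀b, hf₀⟩ := WienerAmalgam.exists_isGivenBy hg hp0 hu
  have hBC : WienerAmalgam.IsBC f₀ := ⟨hf₀c, hf₀b⟩
  have hae := hf₀.ae_eq hf
  have hnu := WienerAmalgam.amalgamNorm_eq_functionNorm g p hf₀
  have hfin : WienerAmalgam.functionNorm g p f₀ ≠ ∞ := by
    rw [← hnu]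
    exact hu.ne
  obtain ⟨v, hv⟩ := (hF.isBC_comp hBC).exists_isGivenBy
  have hnv := WienerAmalgam.amalgamNorm_eq_functionNorm g p hv
  have hmaj : WienerAmalgam.majorant a ((A * K : ℝ≥0) * WienerAmalgam.functionNorm g p f₀) < ∞ :=
    hF.majorant_lt_top (ENNReal.mul_ne_top ENNReal.coe_ne_top hfin)
  have hK : WienerAmalgam.functionNorm (WienerAmalgam.conjugate g) p f₀ ≤
      K * WienerAmalgam.functionNorm g p f₀ := (hK₀ f₀ hBC).trans (by gcongr)
  have hK1' : (1 : ℝ≥0∞) ≤ K := by exact_mod_cast hK1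
  have hbound : WienerAmalgam.functionNorm g p (fun t => F (f₀ t)) ≤
      WienerAmalgam.majorant a ((A * K : ℝ≥0) * WienerAmalgam.functionNorm g p f₀) := by
    have := hF.mul_functionNorm_comp_le hF0 hBC g hp (ENNReal.mul_ne_top ENNReal.coe_ne_top hfin)
      (hmul A hAA) (WienerAmalgam.functionNorm_re_le hBC hp hK1' hK)
      (WienerAmalgam.functionNorm_im_le hBC hp hK1' hK)
    -- With $R=K\|f_0\|$ the argument $AR$ equals $C\|f_0\|$, and $A\ge1$ lets the factor on the
    -- left be dropped.
    rw [← mul_assoc, ← ENNReal.coe_mul] at this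
    exact (le_mul_of_one_le_left' (by exact_mod_cast hA1)).trans this
  refine ⟨v, ?_, hv.congr_ae ?_, ?_, ?_, fun hreal => ?_⟩
  · change WienerAmalgam.amalgamNorm g p 1 v < ∞
    rw [hnv]
    exact hbound.trans_lt hmaj
  · filter_upwards [hae] with x hx
    rw [hx]
  · rwa [hnu]
  · rw [hnu, hnv]
    exact hbound.trans (le_mul_of_one_le_left' (by exact_mod_cast h1C))
  · rw [hnu, hnv]
    -- For a real window conjugation preserves the norm, so $R=\|f_0\|$; taking $C=AK$ itself as
    -- algebra constant puts the same $C$ on both sides.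
    have hc : WienerAmalgam.functionNorm (WienerAmalgam.conjugate g) p f₀ ≤
        1 * WienerAmalgam.functionNorm g p f₀ := by
      rw [WienerAmalgam.conjugate_eq_self hreal, one_mul]
    exact hF.mul_functionNorm_comp_le hF0 hBC g hp hfin (hmul _ (hAA.trans hAC))
      (by simpa using WienerAmalgam.functionNorm_re_le hBC hp le_rfl hc)
      (by simpa using WienerAmalgam.functionNorm_im_le hBC hp le_rfl hc)
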